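/- Let $k$ be a field, let $\mathbb Z^r$ carry a translation-invariant total order $\prec$, and let $A'$ be a $k$-algebra with a valuation $\nu':A'\setminus\{0\}\to\mathbb Z^r$ (so $\nu'(fg)=\nu'(f)+\nu'(g)$ and $\nu'(f+g)\succeq\min\{\nu'(f),\nu'(g)\}$ whenever $f,g,f+g\neq0$) satisfying the standing hypotheses: (1) every nonempty subset of the image of $\nu'$ has a maximum; (2) $A'$ is a finitely generated domain; (3) $\nu'(c)=0$ for all $c\in k^\times$; (4) $\nu'$ has one-dimensional leaves, i.e. $\dim_k F_{\succeq a}/F_{\succ a}\le 1$ for all $a$, where $F_{\succeq a}=\{f:\nu'(f)\succeq a\}\cup\{0\}$ and $F_{\succ a}=\{f:\nu'(f)\succ a\}\cup\{0\}$. Let $A=\bigoplus_{i\ge0}A_i$ be a positively graded $k$-algebra with $A_0=k$, where $A_i\subseteq A'$ are $k$-subspaces with $A_iA_j\subseteq A_{i+j}$ and the multiplication of $A$ is that of $A'$. For $f=\sum_{i=0}^n f_i\in A$ with $f_i\in A_i$ and $f_n\ne0$ put $\nu(f)=(n,\nu'(f_n))\in\mathbb Z^{r+1}$, and order $\mathbb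 Z^{r+1}=\mathbb Z\times\mathbb Z^r$ by $(m,a)\succ(n,b)$ iff $m<n$, or $m=n$ and $a\succ b$. This is a valuation on $A$. Let $g_1,\dots,g_m\in A\setminus\{0\}$ be a finite Khovanskii basis of $A$ with respect to $\nu$, i.e. the classes $g_j+F_{\succ\nu(g_j)}$ generate the $k$-algebra $\operatorname{gr}_\nu(A)=\bigoplus_a F_{\succeq a}(A)/F_{\succ a}(A)$. Let $R=k[x_1,\dots,x_m]$, let $\pi:R\to A$ be the $k$-algebra map $x_j\mapsto g_j$, and $I=\ker\pi$. Let $<$ be the monomial order on $R$ induced by $\nu$ and some tie-breaking monomial order $<'$: $x^\alpha>x^\beta$ iff $\nu(\pi(x^\alpha))\prec\nu(\pi(x^\beta))$, or these values are equal and $x^\alpha>'x^\beta$. For a nonzero $f\in R$ that is not a single term, let its toric exponent be $\alpha_1-\alpha_2\in\mathbb Z^m$, where $x^{\alpha_1}>x^{\alpha_2}$ are the two largest monomials of $f$. Let $K\subseteq\mathbb Z^m$ be the lattice generated by the toric exponents of the nonzero elements of $I$ (none of which is a single term), and let $T$ be the quotient of $\mathbb Z^m/K$ by its torsion subgroup.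 Let $\mu:(R/I)\setminus\{0\}\to T$ send $[f]$ to the class of $-\alpha$, where $x^\alpha$ is the leading monomial of the normal form of $f$, i.e. of the unique representative of $[f]$ that is a linear combination of monomials outside the leading-term ideal of $I$. Grade $R/I$ through the isomorphism $R/I\cong A$ given by $\pi$. Fix any injective group homomorphism $T\hookrightarrow\mathbb Q^n$, and regard $T\subseteq\mathbb Q^n\subseteq\mathbb R^n$. Define the Newton–Okounkov bodies $$\Delta(A,\nu)=\overline{\operatorname{conv}\{\nu'(f)/i: i\ge1,\ f\in A_i\setminus\{0\}\}}\subseteq\mathbb R^r,$$ $$\Delta(R/I,\mu)=\overline{\operatorname{conv}\{\mu(q)/i: i\ge1,\ q\in (R/I)_i\setminus\{0\}\}}\subseteq\mathbb R^n.$$ Then $\Delta(A,\nu)$ and $\Delta(R/I,\mu)$ are both rational polytopes (convex hulls of finitely many rational points, possibly empty), and they are affinely equivalent over $\mathbb Q$: there is an affine map $\mathbb R^n\to\mathbb R^r$ with rational coefficients that takes $\Delta(R/I,\mu)$ onto $\Delta(A,\nu)$ and restricts to a bijection between the affine spans of the two bodies, both over $\mathbb R$ and over $\mathbb Q$ (that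 is, between the $\mathbb Q$-affine spans of their rational points). -/

import Mathlib

open scoped DirectSum

noncomputable section

namespace NewtonOkounkov

/-! ### Valued algebras and the associated graded algebra -/

/-- A (min-)valuation `ν : A ∖ {0} → G` on a `k`-algebra, with values in a totally ordered abelian
group `G`, that lifts the trivial valuation on `kˣ`. It is extended to `A` by `ν 0 = ⊤`, and `⊤` is
attained only at `0`. -/
structure KValuation (k A G : Type*) [Field k] [CommRing A] [Algebra k A] [AddCommGroup G]
    [LinearOrder G] [IsOrderedAddMonoid G] where
  val : AddValuation A (WithTop G)
  eq_zero_of_val_eq_top : ∀ f : A, val f = ⊤ → f = 0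
  val_algebraMap : ∀ c : k, c ≠ 0 → val (algebraMap k A c) = 0

namespace KValuation

section

variable {k A G : Type*} [Field k] [CommRing A] [Algebra k A] [AddCommGroup G]
    [LinearOrder G] [IsOrderedAddMonoid G] (ν : KValuation k A G)

/-- The value of a nonzero element, as an element of `G` (and `0` at the zero element). -/
def value (f : A) : G := (ν.val f).untopD 0

theorem val_eq_value {f : A} (hf : f ≠ 0) : ν.val f = (ν.value f : WithTop G) := by
  have h : ν.val f ≠ ⊤ := fun h => hf (ν.eq_zero_of_val_eq_top f h)
  lift ν.val f to G using h with a ha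
  simp [value, ← ha]

theorem value_le_val (f : A) : (ν.value f : WithTop G) ≤ ν.val f := WithTop.coe_untopD_le _ _

theorem val_le_val_smul (c : k) (f : A) : ν.val f ≤ ν.val (c • f) := by
  rcases eq_or_ne c 0 with rfl | hc
  · simp
  · rw [Algebra.smul_def, AddValuation.map_mul, ν.val_algebraMap c hc, zero_add]

/-- `F_{⪰ a} = {f : ν(f) ⪰ a} ∪ {0}`. -/
def filtGE (a : G) : Submodule k A where
  carrier := {f | (a : WithTop G) ≤ ν.val f}
  zero_mem' := by simp
  add_mem' := fun hf hg => ν.val.map_le_add hf hg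
  smul_mem' := fun c f hf => le_trans hf (ν.val_le_val_smul c f)

/-- `F_{≻ a} = {f : ν(f) ≻ a} ∪ {0}`. -/
def filtGT (a : G) : Submodule k A where
  carrier := {f | (a : WithTop G) < ν.val f}
  zero_mem' := by simp
  add_mem' := fun hf hg => ν.val.map_lt_add hf hg
  smul_mem' := fun c f hf => lt_of_lt_of_le hf (ν.val_le_val_smul c f)

theorem mem_filtGE {a : G} {f : A} : f ∈ ν.filtGE a ↔ (a : WithTop G) ≤ ν.val f := Iff.rfl

theorem mem_filtGT {a : G} {f : A} : f ∈ ν.filtGT a ↔ (a : WithTop G) < ν.val f := Iff.rfl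

/-- The leaf `F_{⪰ a} / F_{≻ a}`. -/
def Leaf (a : G) : Type _ := ν.filtGE a ⧸ (ν.filtGT a).submoduleOf (ν.filtGE a)

instance leafAddCommGroup (a : G) : AddCommGroup (ν.Leaf a) :=
  inferInstanceAs (AddCommGroup (ν.filtGE a ⧸ (ν.filtGT a).submoduleOf (ν.filtGE a)))

instance leafModule (a : G) : Module k (ν.Leaf a) :=
  inferInstanceAs (Module k (ν.filtGE a ⧸ (ν.filtGT a).submoduleOf (ν.filtGE a)))

/-- The quotient map `F_{⪰ a} → F_{⪰ a} / F_{≻ a}`. -/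
def leafMk {a : G} : ν.filtGE a →ₗ[k] ν.Leaf a := ((ν.filtGT a).submoduleOf (ν.filtGE a)).mkQ

theorem leafMk_surjective {a : G} : Function.Surjective (ν.leafMk (a := a)) :=
  Submodule.mkQ_surjective _

theorem leafMk_eq {a : G} {f g : ν.filtGE a} :
    ν.leafMk f = ν.leafMk g ↔ (f : A) - g ∈ ν.filtGT a := by
  exact Submodule.Quotient.eq _

theorem mul_mem {a b : G} (f : ν.filtGE a) (g : ν.filtGE b) : (f : A) * g ∈ ν.filtGE (a + b) := by
  rw [mem_filtGE, AddValuation.map_mul, WithTop.coe_add]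
  exact add_le_add f.2 g.2

theorem mul_mem_left {a b : G} {f g : A} (hf : f ∈ ν.filtGT a) (hg : g ∈ ν.filtGE b) :
    f * g ∈ ν.filtGT (a + b) := by
  rw [mem_filtGT, AddValuation.map_mul, WithTop.coe_add]
  exact WithTop.add_lt_add_of_lt_of_le WithTop.coe_ne_top hf hg

theorem mul_mem_right {a b : G} {f g : A} (hf : f ∈ ν.filtGE a) (hg : g ∈ ν.filtGT b) :
    f * g ∈ ν.filtGT (a + b) := by
  rw [mul_comm, add_comm a b]
  exact ν.mul_mem_left hg hf

/-- Multiplication `F_{⪰ a} / F_{≻ a} × F_{⪰ b} / F_{≻ b} → F_{⪰ a + b} / F_{≻ a + b}`, induced by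
the multiplication of `A`. -/
def leafMul {a b : G} (x : ν.Leaf a) (y : ν.Leaf b) : ν.Leaf (a + b) :=
  Quotient.liftOn₂' x y (fun f g => ν.leafMk ⟨(f : A) * g, ν.mul_mem f g⟩) (by
    intro f g f' g' hf hg
    have hf' : (f : A) - f' ∈ ν.filtGT a := ν.leafMk_eq.1 (Quotient.sound' hf)
    have hg' : (g : A) - g' ∈ ν.filtGT b := ν.leafMk_eq.1 (Quotient.sound' hg)
    refine ν.leafMk_eq.2 ?_
    have h : (f : A) * g - f' * g' = (f - f') * g + f' * (g - g') := by ring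
    exact h ▸ add_mem (ν.mul_mem_left hf' g.2) (ν.mul_mem_right f'.2 hg'))

theorem leafMul_mk {a b : G} (f : ν.filtGE a) (g : ν.filtGE b) :
    ν.leafMul (ν.leafMk f) (ν.leafMk g) = ν.leafMk ⟨(f : A) * g, ν.mul_mem f g⟩ := rfl

theorem algebraMap_mem (c : k) : algebraMap k A c ∈ ν.filtGE 0 := by
  rw [mem_filtGE, Algebra.algebraMap_eq_smul_one]
  exact le_trans (by simp) (ν.val_le_val_smul c 1)

theorem gradedMk_eq {a b : G} (f : ν.filtGE a) (g : ν.filtGE b) (h : a = b) (hfg : (f : A) = g) :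
    (GradedMonoid.mk a (ν.leafMk f) : GradedMonoid ν.Leaf) = GradedMonoid.mk b (ν.leafMk g) := by
  subst h
  rw [Subtype.ext hfg]

theorem graded_cases (x : GradedMonoid ν.Leaf) :
    ∃ (a : G) (f : ν.filtGE a), x = GradedMonoid.mk a (ν.leafMk f) := by
  obtain ⟨a, x⟩ := x
  obtain ⟨f, rfl⟩ := ν.leafMk_surjective x
  exact ⟨a, f, rfl⟩

instance leafGMul : GradedMonoid.GMul ν.Leaf := ⟨fun x y => ν.leafMul x y⟩

instance leafGOne : GradedMonoid.GOne ν.Leaf :=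
  ⟨ν.leafMk ⟨1, by simpa using ν.algebraMap_mem 1⟩⟩

theorem gradedMk_mul {a b : G} (f : ν.filtGE a) (g : ν.filtGE b) :
    (GradedMonoid.mk a (ν.leafMk f) : GradedMonoid ν.Leaf) * GradedMonoid.mk b (ν.leafMk g) =
      GradedMonoid.mk (a + b) (ν.leafMk ⟨(f : A) * g, ν.mul_mem f g⟩) := rfl

theorem gradedMk_one :
    (1 : GradedMonoid ν.Leaf) =
      GradedMonoid.mk 0 (ν.leafMk ⟨1, by simpa using ν.algebraMap_mem 1⟩) := rfl

instance leafGCommRing : DirectSum.GCommRing ν.Leaf where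
  mul_zero := by
    intro a b x
    obtain ⟨f, rfl⟩ := ν.leafMk_surjective x
    exact ν.leafMk_eq.2 (by simp)
  zero_mul := by
    intro a b x
    obtain ⟨f, rfl⟩ := ν.leafMk_surjective x
    exact ν.leafMk_eq.2 (by simp)
  mul_add := by
    intro a b x y z
    obtain ⟨f, rfl⟩ := ν.leafMk_surjective x
    obtain ⟨g, rfl⟩ := ν.leafMk_surjective y
    obtain ⟨h, rfl⟩ := ν.leafMk_surjective z
    exact ν.leafMk_eq.2 (by simp [mul_add])
  add_mul := by
    intro a b x y z
    obtain ⟨f, rfl⟩ := ν.leafMk_surjective x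
    obtain ⟨g, rfl⟩ := ν.leafMk_surjective y
    obtain ⟨h, rfl⟩ := ν.leafMk_surjective z
    exact ν.leafMk_eq.2 (by simp [add_mul])
  one_mul := by
    intro x
    obtain ⟨a, f, rfl⟩ := ν.graded_cases x
    rw [gradedMk_one, gradedMk_mul]
    exact ν.gradedMk_eq _ _ (by simp) (by simp)
  mul_one := by
    intro x
    obtain ⟨a, f, rfl⟩ := ν.graded_cases x
    rw [gradedMk_one, gradedMk_mul]
    exact ν.gradedMk_eq _ _ (by simp) (by simp)
  mul_assoc := by
    intro x y z
    obtain ⟨a, f, rfl⟩ := ν.graded_cases x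
    obtain ⟨b, g, rfl⟩ := ν.graded_cases y
    obtain ⟨c, h, rfl⟩ := ν.graded_cases z
    simp only [gradedMk_mul]
    exact ν.gradedMk_eq _ _ (add_assoc _ _ _) (mul_assoc _ _ _)
  mul_comm := by
    intro x y
    obtain ⟨a, f, rfl⟩ := ν.graded_cases x
    obtain ⟨b, g, rfl⟩ := ν.graded_cases y
    simp only [gradedMk_mul]
    exact ν.gradedMk_eq _ _ (add_comm _ _) (mul_comm _ _)
  natCast := fun n => n • ν.leafMk ⟨1, by simpa using ν.algebraMap_mem 1⟩
  natCast_zero := zero_nsmul _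
  natCast_succ := fun n => succ_nsmul _ n
  intCast := fun n => n • ν.leafMk ⟨1, by simpa using ν.algebraMap_mem 1⟩
  intCast_ofNat := fun n => natCast_zsmul _ n
  intCast_negSucc_ofNat := fun n => negSucc_zsmul _ n

instance leafGAlgebra : DirectSum.GAlgebra k ν.Leaf where
  toFun :=
    { toFun := fun c => ν.leafMk ⟨algebraMap k A c, ν.algebraMap_mem c⟩
      map_zero' := (congrArg ν.leafMk (Subtype.ext (by simp))).trans (map_zero _)
      map_add' := fun c d => (congrArg ν.leafMk (Subtype.ext (by simp))).trans (map_add _ _ _) }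
  map_one := ν.leafMk_eq.2 (by simp)
  map_mul := fun c d => ν.gradedMk_eq _ _ (by simp) (by simp)
  commutes := by
    intro c x
    obtain ⟨a, f, rfl⟩ := ν.graded_cases x
    exact ν.gradedMk_eq _ _ (add_comm _ _) (mul_comm _ _)
  smul_def := by
    intro c x
    obtain ⟨a, f, rfl⟩ := ν.graded_cases x
    exact ν.gradedMk_eq (c • f) _ (zero_add a).symm (by simp [Algebra.smul_def])

/-- The associated graded algebra `gr_ν(A) = ⨁_a F_{⪰ a} / F_{≻ a}`. -/
abbrev Gr : Type _ := ⨁ a : G, ν.Leaf a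

/-- The image `f + F_{≻ ν(f)}` of `f` in the associated graded algebra. -/
def initialForm (f : A) : ν.Gr :=
  DirectSum.of ν.Leaf (ν.value f) (ν.leafMk ⟨f, ν.value_le_val f⟩)

/-- A finite family of nonzero elements is a Khovanskii basis if its images generate `gr_ν(A)` as a
`k`-algebra. -/
def IsKhovanskiiBasis {m : ℕ} (g : Fin m → A) : Prop :=
  (∀ j, g j ≠ 0) ∧ Algebra.adjoin k (Set.range fun j => ν.initialForm (g j)) = ⊤

/-- The image of `A ∖ {0}` under the valuation. -/
def valueSet : Set G := {a | ∃ f : A, f ≠ 0 ∧ ν.value f = a}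

/-- The standing hypotheses on a valued algebra (the valuation being trivial on `kˣ` is part of
`KValuation`). -/
structure StandingHypotheses : Prop where
  /-- Every nonempty subset of the image of `ν` has a maximum. -/
  wellOrdered : ν.valueSet.WellFoundedOn (· > ·)
  isDomain : IsDomain A
  finiteType : Algebra.FiniteType k A
  /-- `ν` has one-dimensional leaves. -/
  leaves : ∀ a : G, Module.rank k (ν.Leaf a) ≤ 1

end

/-! ### The induced valuation on a graded algebra -/

section

variable {k A' Γ : Type*} [Field k] [CommRing A'] [Algebra k A'] [AddCommGroup Γ]
    [LinearOrder Γ] [IsOrderedAddMonoid Γ] (ν' : KValuation k A' Γ)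

theorem noZeroDivisors (ν' : KValuation k A' Γ) : NoZeroDivisors A' := by
  refine ⟨fun {a b} h => ?_⟩
  by_contra! hab
  have h1 := ν'.val.map_mul a b
  rw [h, ν'.val_eq_value hab.1, ν'.val_eq_value hab.2, AddValuation.map_zero,
    ← WithTop.coe_add] at h1
  exact WithTop.top_ne_coe h1

/-- The value `(n, ν'(c))` of a nonzero polynomial `p = c tⁿ + (lower order terms)`. In
`ℤᵒᵈ ×ₗ Γ` one has `(m, a) ≻ (n, b)` iff `m < n`, or `m = n` and `a ≻ b`. -/
def polyVal (p : Polynomial A') : WithTop (ℤᵒᵈ ×ₗ Γ) :=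
  (ν'.val p.leadingCoeff).map fun a => toLex (OrderDual.toDual (p.natDegree : ℤ), a)

theorem polyVal_zero : ν'.polyVal 0 = ⊤ := by simp [polyVal]

theorem polyVal_of_ne_zero {p : Polynomial A'} (hp : p ≠ 0) :
    ν'.polyVal p = ((toLex (OrderDual.toDual (p.natDegree : ℤ), ν'.value p.leadingCoeff) :
      ℤᵒᵈ ×ₗ Γ) : WithTop (ℤᵒᵈ ×ₗ Γ)) := by
  rw [polyVal, ν'.val_eq_value (by simpa using hp)]
  rfl

theorem le_polyVal_iff {p : Polynomial A'} {n : ℕ} {a : Γ} :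
    ((toLex (OrderDual.toDual (n : ℤ), a) : ℤᵒᵈ ×ₗ Γ) : WithTop (ℤᵒᵈ ×ₗ Γ)) ≤ ν'.polyVal p ↔
      p.natDegree ≤ n ∧ (a : WithTop Γ) ≤ ν'.val (p.coeff n) := by
  rcases eq_or_ne p 0 with rfl | hp
  · simp [polyVal_zero]
  rw [ν'.polyVal_of_ne_zero hp, WithTop.coe_le_coe, Prod.Lex.le_iff]
  simp only [ofLex_toLex, OrderDual.toDual_lt_toDual, Nat.cast_lt,
    OrderDual.toDual_inj, Nat.cast_inj]
  constructor
  · rintro (h | ⟨rfl, h⟩)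
    · exact ⟨h.le, by simp [Polynomial.coeff_eq_zero_of_natDegree_lt h]⟩
    · refine ⟨le_rfl, ?_⟩
      rw [Polynomial.coeff_natDegree, ν'.val_eq_value (by simpa using hp)]
      exact WithTop.coe_le_coe.2 h
  · rintro ⟨h1, h2⟩
    rcases h1.lt_or_eq with h | rfl
    · exact Or.inl h
    · refine Or.inr ⟨rfl, ?_⟩
      rw [Polynomial.coeff_natDegree, ν'.val_eq_value (by simpa using hp)] at h2
      exact WithTop.coe_le_coe.1 h2

/-- The valuation `p = c tⁿ + (lower order terms) ↦ (n, ν'(c))` on `A'[t]`. -/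
def polyValuation : AddValuation (Polynomial A') (WithTop (ℤᵒᵈ ×ₗ Γ)) :=
  AddValuation.of ν'.polyVal ν'.polyVal_zero
    (by
      have : Nontrivial A' := ⟨1, 0, fun h => by simpa [h] using ν'.val.map_one⟩
      rw [polyVal, Polynomial.leadingCoeff_one, AddValuation.map_one, Polynomial.natDegree_one]
      rfl)
    (by
      intro p q
      have key : ∀ p q : Polynomial A', ν'.polyVal p ≤ ν'.polyVal q →
          ν'.polyVal p ≤ ν'.polyVal (p + q) := by
        intro p q hpq
        rcases eq_or_ne p 0 with rfl | hp
        · rw [zero_add]; exact hpq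
        have h1 : ν'.polyVal p ≤ ν'.polyVal p := le_rfl
        rw [ν'.polyVal_of_ne_zero hp] at hpq ⊢
        nth_rewrite 1 [ν'.polyVal_of_ne_zero hp] at h1
        rw [le_polyVal_iff] at hpq h1 ⊢
        refine ⟨Polynomial.natDegree_add_le_of_degree_le h1.1 hpq.1, ?_⟩
        rw [Polynomial.coeff_add]
        exact ν'.val.map_le_add h1.2 hpq.2
      rcases le_total (ν'.polyVal p) (ν'.polyVal q) with h | h
      · exact (min_le_left _ _).trans (key p q h)
      · rw [add_comm]; exact (min_le_right _ _).trans (key q p h))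
    (by
      intro p q
      have := ν'.noZeroDivisors
      rcases eq_or_ne p 0 with rfl | hp
      · simp [polyVal_zero]
      rcases eq_or_ne q 0 with rfl | hq
      · simp [polyVal_zero]
      have h := ν'.val.map_mul p.leadingCoeff q.leadingCoeff
      rw [ν'.val_eq_value (Polynomial.leadingCoeff_ne_zero.2 hp),
        ν'.val_eq_value (Polynomial.leadingCoeff_ne_zero.2 hq), ← Polynomial.leadingCoeff_mul,
        ν'.val_eq_value (Polynomial.leadingCoeff_ne_zero.2 (mul_ne_zero hp hq)),
        ← WithTop.coe_add, WithTop.coe_inj] at h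
      rw [ν'.polyVal_of_ne_zero hp, ν'.polyVal_of_ne_zero hq,
        ν'.polyVal_of_ne_zero (mul_ne_zero hp hq), h, Polynomial.natDegree_mul hp hq,
        ← WithTop.coe_add]
      congr 1)

variable (𝒜 : ℕ → Submodule k A') [SetLike.GradedMonoid 𝒜]

/-- The embedding `⨁ Aᵢ → A'[t]`, `∑ fᵢ ↦ ∑ fᵢ tⁱ`. -/
def toPoly : (⨁ i, 𝒜 i) →ₐ[k] Polynomial A' :=
  DirectSum.toAlgebra k (fun i => 𝒜 i)
    (fun i => ((Polynomial.monomial i).restrictScalars k) ∘ₗ (𝒜 i).subtype)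
    (by
      show Polynomial.monomial 0 (1 : A') = 1
      simp)
    (by
      intro i j f g
      show Polynomial.monomial (i + j) ((f : A') * g) =
        Polynomial.monomial i (f : A') * Polynomial.monomial j (g : A')
      rw [Polynomial.monomial_mul_monomial])

theorem toPoly_of (i : ℕ) (f : 𝒜 i) :
    toPoly 𝒜 (DirectSum.of (fun i => 𝒜 i) i f) = Polynomial.monomial i (f : A') := by
  exact DirectSum.toAddMonoid_of (β := fun i => 𝒜 i)
    (fun i => (((Polynomial.monomial i).restrictScalars k) ∘ₗ (𝒜 i).subtype).toAddMonoidHom) i f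

theorem coeff_toPoly (f : ⨁ i, 𝒜 i) (i : ℕ) : (toPoly 𝒜 f).coeff i = (f i : A') := by
  induction f using DirectSum.induction_on with
  | zero => simp
  | of j f =>
    rw [toPoly_of, Polynomial.coeff_monomial, DirectSum.of_apply]
    split_ifs with h
    · subst h; rfl
    · rfl
  | add f g hf hg => simp [hf, hg]

theorem toPoly_injective : Function.Injective (toPoly 𝒜) := by
  intro f g h
  refine DFinsupp.ext fun i => Subtype.ext ?_
  rw [← coeff_toPoly, ← coeff_toPoly, h]

/-- The valuation on the graded algebra `A = ⨁ Aᵢ` induced by `ν'`: if `f = ∑_{i ≤ n} fᵢ` with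
`fᵢ ∈ Aᵢ` and `fₙ ≠ 0`, then `ν(f) = (n, ν'(fₙ))`. -/
def induced : KValuation k (⨁ i, 𝒜 i) (ℤᵒᵈ ×ₗ Γ) where
  val := ν'.polyValuation.comap (toPoly 𝒜).toRingHom
  eq_zero_of_val_eq_top := by
    intro f hf
    by_contra hne
    have h0 : toPoly 𝒜 f ≠ 0 := by
      rw [Ne, map_eq_zero_iff _ (toPoly_injective 𝒜)]; exact hne
    have h1 : ν'.polyVal (toPoly 𝒜 f) = ⊤ := hf
    rw [ν'.polyVal_of_ne_zero h0] at h1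
    exact WithTop.coe_ne_top h1
  val_algebraMap := by
    intro c hc
    show ν'.polyVal (toPoly 𝒜 (algebraMap k _ c)) = 0
    rw [AlgHom.commutes, Polynomial.algebraMap_apply, polyVal, Polynomial.leadingCoeff_C,
      ν'.val_algebraMap c hc, Polynomial.natDegree_C]
    rfl

/-- The defining formula of the induced valuation. -/
theorem induced_value {f : ⨁ i, 𝒜 i} {n : ℕ} (hn : f n ≠ 0) (hlt : ∀ i, n < i → f i = 0) :
    (ν'.induced 𝒜).value f = toLex (OrderDual.toDual (n : ℤ), ν'.value (f n : A')) := by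
  have h0 : (toPoly 𝒜 f).coeff n ≠ 0 := by
    rw [coeff_toPoly]; simpa using hn
  have hdeg : (toPoly 𝒜 f).natDegree = n := by
    refine le_antisymm (Polynomial.natDegree_le_iff_coeff_eq_zero.2 fun i hi => ?_)
      (Polynomial.le_natDegree_of_ne_zero h0)
    rw [coeff_toPoly, hlt i hi]; rfl
  have h1 : toPoly 𝒜 f ≠ 0 := fun h => h0 (by simp [h])
  show (ν'.polyVal (toPoly 𝒜 f)).untopD 0 = _
  rw [ν'.polyVal_of_ne_zero h1, WithTop.untopD_coe, Polynomial.leadingCoeff, hdeg, coeff_toPoly]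

end

end KValuation

/-! ### Presentation, monomial order, normal forms, and the map `μ` -/

section

variable {k A G : Type*} [Field k] [CommRing A] [Algebra k A] [AddCommGroup G]
    [LinearOrder G] [IsOrderedAddMonoid G] {m : ℕ}

/-- `ord` is the monomial order induced by the valuation `ν` through the presentation `xᵢ ↦ gᵢ`,
with ties broken by the monomial order `tie`: one has `x^α > x^β` iff `ν(g^α) ≺ ν(g^β)`, or
`ν(g^α) = ν(g^β)` and `x^α >' x^β`. -/
def IsInducedOrder (ν : KValuation k A G) (g : Fin m → A) (tie ord : MonomialOrder (Fin m)) :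
    Prop :=
  ∀ α β : Fin m →₀ ℕ, ord.toSyn β < ord.toSyn α ↔
    ν.val (MvPolynomial.aeval g (MvPolynomial.monomial α (1 : k))) <
        ν.val (MvPolynomial.aeval g (MvPolynomial.monomial β (1 : k))) ∨
      (ν.val (MvPolynomial.aeval g (MvPolynomial.monomial α (1 : k))) =
        ν.val (MvPolynomial.aeval g (MvPolynomial.monomial β (1 : k))) ∧
      tie.toSyn β < tie.toSyn α)

/-- For a valuation whose image is maximum-well-ordered the induced monomial order exists. -/
theorem exists_isInducedOrder (ν : KValuation k A G) (hν : ν.valueSet.WellFoundedOn (· > ·))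
    (g : Fin m → A) (hg : ∀ j, g j ≠ 0) (tie : MonomialOrder (Fin m)) :
    ∃ ord : MonomialOrder.{0, 0} (Fin m), IsInducedOrder ν g tie ord := by
  have hdom := ν.noZeroDivisors
  have hnt : Nontrivial A := ⟨1, 0, fun h => by simpa [h] using ν.val.map_one⟩
  set x : (Fin m →₀ ℕ) → A := fun α => MvPolynomial.aeval g (MvPolynomial.monomial α (1 : k)) with hx
  have hx0 : ∀ α, x α ≠ 0 := by
    intro α
    simp only [hx, MvPolynomial.aeval_monomial, map_one, one_mul, Finsupp.prod]
    exact Finset.prod_ne_zero_iff.2 fun i _ => pow_ne_zero _ (hg i)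
  have hxadd : ∀ α β, x (α + β) = x α * x β := by
    intro α β
    simp only [hx]
    rw [← map_mul, MvPolynomial.monomial_mul, one_mul]
  have hmul : ∀ f h : A, f ≠ 0 → h ≠ 0 → ν.value (f * h) = ν.value f + ν.value h := by
    intro f h hf hh
    have := ν.val.map_mul f h
    rw [ν.val_eq_value hf, ν.val_eq_value hh, ν.val_eq_value (mul_ne_zero hf hh)] at this
    exact WithTop.coe_inj.1 this
  have hone : ν.value 1 = 0 := by
    simp [KValuation.value]
  have hnonpos : ∀ f : A, f ≠ 0 → ν.value f ≤ 0 := by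
    intro f hf
    by_contra! hpos
    have hpow : ∀ n : ℕ, ν.value (f ^ n) = n • ν.value f := by
      intro n
      induction n with
      | zero => simp [hone]
      | succ n ih => rw [pow_succ, hmul _ _ (pow_ne_zero _ hf) hf, ih, succ_nsmul]
    refine Set.wellFoundedOn_iff_no_descending_seq.1 hν
      (RelEmbedding.natGT (fun n => ν.value (f ^ n)) fun n => ?_)
      fun n => ⟨f ^ n, pow_ne_zero _ hf, rfl⟩
    show ν.value (f ^ n) < ν.value (f ^ (n + 1))
    rw [hpow, hpow, succ_nsmul]
    exact lt_add_of_pos_right _ hpos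
  let P : (Fin m →₀ ℕ) → Gᵒᵈ ×ₗ tie.syn :=
    fun α => toLex (OrderDual.toDual (ν.value (x α)), tie.toSyn α)
  have hPinj : Function.Injective P := fun α β h =>
    tie.toSyn.injective (congrArg Prod.snd (toLex.injective h))
  have hPadd : ∀ α β, P (α + β) = P α + P β := by
    intro α β
    simp only [P, hxadd, hmul _ _ (hx0 _) (hx0 _), map_add]
    rfl
  have hPnonneg : ∀ α, 0 ≤ P α := by
    intro α
    refine Prod.Lex.le_iff.2 ?_
    rcases (hnonpos _ (hx0 α)).lt_or_eq with h | h
    · exact Or.inl h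
    · exact Or.inr ⟨congrArg OrderDual.toDual h.symm, tie.zero_le _⟩
  let L : LinearOrder (Fin m →₀ ℕ) := LinearOrder.lift' P hPinj
  have hlt : ∀ α β, L.lt α β ↔ P α < P β := fun _ _ => Iff.rfl
  have hwf : WellFounded (fun α β => P α < P β) := by
    have h := WellFounded.prod_lex_of_wellFoundedOn_fiber
      (rα := fun a b : G => a > b) (rβ := fun a b : tie.syn => a < b)
      (f := fun α => ν.value (x α)) (g := fun α => tie.toSyn α)
      (InvImage.wf (fun α => (⟨ν.value (x α), x α, hx0 α, rfl⟩ : ν.valueSet)) hν)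
      (fun a => (InvImage.wf tie.toSyn wellFounded_lt).wellFoundedOn)
    refine Subrelation.wf (fun {α β} hab => ?_) h
    rcases Prod.Lex.lt_iff.1 hab with h | ⟨h, h'⟩
    · exact Prod.Lex.left _ _ h
    · show Prod.Lex _ _ (ν.value (x α), tie.toSyn α) (ν.value (x β), tie.toSyn β)
      have h1 : ν.value (x α) = ν.value (x β) := h
      rw [h1]
      exact Prod.Lex.right _ h'
  refine ⟨{ syn := Fin m →₀ ℕ
            addCommMonoidSyn := inferInstance
            linearOrderSyn := L
            isOrderedAddMonoid_syn := @IsOrderedAddMonoid.mk _ _ L.toPreorder ?_ ?_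
            toSyn := AddEquiv.refl _
            toSyn_monotone := ?_
            wellFoundedLT_syn := ⟨hwf⟩ }, ?_⟩
  · intro α β h γ
    show P (α + γ) ≤ P (β + γ)
    rw [hPadd, hPadd]
    exact add_le_add_left (show P α ≤ P β from h) _
  · intro α β h γ
    show P (γ + α) ≤ P (γ + β)
    rw [hPadd, hPadd]
    exact add_le_add_right (show P α ≤ P β from h) _
  · intro α β h
    show P α ≤ P β
    obtain ⟨γ, rfl⟩ := le_iff_exists_add.1 h
    rw [hPadd]
    exact le_add_of_nonneg_right (hPnonneg γ)
  · intro α β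
    show P β < P α ↔ _
    rw [Prod.Lex.lt_iff]
    have h1 : ∀ α, ν.val (MvPolynomial.aeval g (MvPolynomial.monomial α (1 : k))) =
        (ν.value (x α) : WithTop G) := fun α => ν.val_eq_value (hx0 α)
    rw [h1, h1, WithTop.coe_lt_coe, WithTop.coe_inj]
    refine or_congr Iff.rfl (and_congr ?_ Iff.rfl)
    exact ⟨fun h => Eq.symm h, fun h => Eq.symm h⟩

variable (ord : MonomialOrder (Fin m)) (I : Ideal (MvPolynomial (Fin m) k))

/-- `x^α` is a standard monomial: it does not lie in the ideal `lt(I)` of leading terms. -/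
def IsStandard (α : Fin m →₀ ℕ) : Prop :=
  MvPolynomial.monomial α (1 : k) ∉ Ideal.span (ord.leadingTerm '' (I : Set (MvPolynomial (Fin m) k)))

/-- Every class of `R / I` has exactly one representative that is a linear combination of standard
monomials. -/
theorem existsUnique_normalForm (q : MvPolynomial (Fin m) k ⧸ I) :
    ∃! f : MvPolynomial (Fin m) k, Ideal.Quotient.mk I f = q ∧
      ∀ α ∈ f.support, IsStandard ord I α := by
  obtain ⟨f, rfl⟩ := Ideal.Quotient.mk_surjective q
  have hst : ∀ c : Fin m →₀ ℕ, IsStandard ord I c ↔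
      ∀ b ∈ I, b ≠ 0 → ¬ ord.degree b ≤ c := by
    intro c
    have hspan : Ideal.span (ord.leadingTerm '' (I : Set (MvPolynomial (Fin m) k))) =
        Ideal.span ((fun s => MvPolynomial.monomial s (1 : k)) ''
          (ord.degree '' {b | b ∈ I ∧ b ≠ 0})) := by
      apply le_antisymm
      · rw [Ideal.span_le]
        rintro _ ⟨b, hb, rfl⟩
        rcases eq_or_ne b 0 with rfl | hb0
        · simp
        have : ord.leadingTerm b = MvPolynomial.C (ord.leadingCoeff b) *
            MvPolynomial.monomial (ord.degree b) (1 : k) := by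
          rw [MonomialOrder.leadingTerm, MvPolynomial.C_mul_monomial, mul_one]
        rw [this]
        exact Ideal.mul_mem_left _ _ (Ideal.subset_span ⟨_, ⟨b, ⟨hb, hb0⟩, rfl⟩, rfl⟩)
      · rw [Ideal.span_le]
        rintro _ ⟨_, ⟨b, ⟨hb, hb0⟩, rfl⟩, rfl⟩
        have hc : ord.leadingCoeff b ≠ 0 := by simpa using hb0
        have : MvPolynomial.monomial (ord.degree b) (1 : k) =
            MvPolynomial.C (ord.leadingCoeff b)⁻¹ * ord.leadingTerm b := by
          rw [MonomialOrder.leadingTerm, MvPolynomial.C_mul_monomial, inv_mul_cancel₀ hc]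
        show MvPolynomial.monomial (ord.degree b) (1 : k) ∈ _
        rw [this]
        exact Ideal.mul_mem_left _ _ (Ideal.subset_span ⟨b, hb, rfl⟩)
    rw [IsStandard, hspan, MvPolynomial.mem_ideal_span_monomial_image]
    classical
    simp [MvPolynomial.support_monomial]
  obtain ⟨c, r, hf, -, hr⟩ := ord.div_set (B := {b | b ∈ I ∧ b ≠ 0})
    (fun b hb => by simpa using hb.2) f
  have hrf : f - r ∈ I := by
    rw [hf, add_sub_cancel_right, Finsupp.linearCombination_apply]
    exact Ideal.sum_mem _ fun b _ => Ideal.mul_mem_left _ _ b.2.1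
  refine ⟨r, ⟨?_, fun α hα => (hst α).2 fun b hb hb0 => hr α hα b ⟨hb, hb0⟩⟩, ?_⟩
  · rw [eq_comm, Ideal.Quotient.eq]; exact hrf
  · rintro s ⟨hs, hs'⟩
    by_contra hne
    have hsr : s - r ∈ I := by
      rw [Ideal.Quotient.eq] at hs
      have := I.add_mem hs hrf
      simpa using this
    have h0 : s - r ≠ 0 := sub_ne_zero.2 hne
    have hmem : ord.degree (s - r) ∈ (s - r).support := ord.degree_mem_support h0
    classical
    rcases Finset.mem_union.1 (MvPolynomial.support_sub _ s r hmem) with h | h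
    · exact (hst _).1 (hs' _ h) _ hsr h0 le_rfl
    · exact hr _ h _ ⟨hsr, h0⟩ le_rfl

/-- The normal form of a class of `R / I`: its representative composed of standard monomials. -/
def normalForm (q : MvPolynomial (Fin m) k ⧸ I) : MvPolynomial (Fin m) k :=
  (existsUnique_normalForm ord I q).choose

/-- The toric exponent of a polynomial with at least two terms: the difference of the exponents of
its two largest monomials (`subLTerm f` is `f` minus its leading term). -/
def toricExponent (f : MvPolynomial (Fin m) k) : Fin m → ℤ :=
  fun i => (ord.degree f i : ℤ) - (ord.degree (ord.subLTerm f) i : ℤ)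

/-- The lattice `K ⊆ ℤᵐ` generated by the toric exponents of the elements of `I` that are neither
zero nor a single term. -/
def latticeK : Submodule ℤ (Fin m → ℤ) :=
  Submodule.span ℤ {v | ∃ f ∈ I, f ≠ 0 ∧ ord.subLTerm f ≠ 0 ∧ v = toricExponent ord f}

/-- The torsion-free portion of `ℤᵐ / K`. -/
abbrev TorFree (K : Submodule ℤ (Fin m → ℤ)) : Type :=
  ((Fin m → ℤ) ⧸ K) ⧸ Submodule.torsion ℤ ((Fin m → ℤ) ⧸ K)

/-- The class of an integer vector in the torsion-free portion of `ℤᵐ / K`. -/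
def torFreeMk (K : Submodule ℤ (Fin m → ℤ)) (v : Fin m → ℤ) : TorFree K :=
  Submodule.Quotient.mk (Submodule.Quotient.mk v)

/-- The map `μ`, sending a nonzero class `[f]` to the class of minus the exponent of the leading
monomial of its normal form. -/
def mu (q : MvPolynomial (Fin m) k ⧸ I) : TorFree (latticeK ord I) :=
  torFreeMk _ fun i => -(ord.degree (normalForm ord I q) i : ℤ)

end

/-! ### Newton–Okounkov bodies and polytopes -/

/-- The Newton–Okounkov body of pieces `Eᵢ ⊆ B` and values `v : B ∖ {0} → ℝⁿ`: the closed convex hull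
of `{v(f) / i : i ≥ 1, f ∈ Eᵢ ∖ {0}}`. -/
def body {B : Type*} [Zero B] {n : ℕ} (E : ℕ → Set B) (v : B → Fin n → ℝ) : Set (Fin n → ℝ) :=
  closure (convexHull ℝ {x | ∃ i : ℕ, 0 < i ∧ ∃ f ∈ E i, f ≠ 0 ∧ x = (i : ℝ)⁻¹ • v f})

section

variable {k A' Γ : Type*} [Field k] [CommRing A'] [Algebra k A'] [AddCommGroup Γ]
    [LinearOrder Γ] [IsOrderedAddMonoid Γ] (ν' : KValuation k A' Γ)
    (𝒜 : ℕ → Submodule k A')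

/-- `Δ(A, ν) ⊆ ℝʳ`, where `e` identifies the value group of `ν'` with `ℤʳ`. -/
def bodyA {r : ℕ} (e : Γ ≃+ (Fin r → ℤ)) : Set (Fin r → ℝ) :=
  body (fun i => (𝒜 i : Set A')) (fun f j => (e (ν'.value f) j : ℝ))

variable [SetLike.GradedMonoid 𝒜] {m : ℕ} (g : Fin m → ⨁ i, 𝒜 i)

/-- The kernel `I` of the presentation map `π : k[x₁, …, xₘ] → A`, `xᵢ ↦ gᵢ`. -/
abbrev presIdeal : Ideal (MvPolynomial (Fin m) k) :=
  RingHom.ker (MvPolynomial.aeval (R := k) g)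

/-- The grading of `R / I`, transported from `A` by the presentation map. -/
def presPiece (i : ℕ) : Set (MvPolynomial (Fin m) k ⧸ presIdeal 𝒜 g) :=
  {q | ∃ f : 𝒜 i, Ideal.kerLiftAlg (MvPolynomial.aeval (R := k) g) q =
    DirectSum.of (fun i => 𝒜 i) i f}

/-- `Δ(R / I, μ) ⊆ ℝⁿ`, where `ι` embeds the torsion-free portion of `ℤᵐ / K` in `ℚⁿ`. -/
def bodyRI (ord : MonomialOrder (Fin m)) {n : ℕ}
    (ι : TorFree (latticeK ord (presIdeal 𝒜 g)) →ₗ[ℤ] (Fin n → ℚ)) : Set (Fin n → ℝ) :=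
  body (presPiece 𝒜 g) (fun q j => (ι (mu ord (presIdeal 𝒜 g) q) j : ℝ))

end

/-- The inclusion `ℚⁿ ⊆ ℝⁿ`. -/
def ratVec {n : ℕ} (v : Fin n → ℚ) : Fin n → ℝ := fun j => (v j : ℝ)

/-- A rational polytope: the convex hull of finitely many rational points. -/
def IsRationalPolytope {n : ℕ} (P : Set (Fin n → ℝ)) : Prop :=
  ∃ S : Finset (Fin n → ℚ), P = convexHull ℝ (ratVec '' (S : Set (Fin n → ℚ)))

/-- `P` and `Q` are affinely equivalent over `ℚ`: an affine map `φ` with rational coefficients takes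
`P` onto `Q` and is invertible as a map from the affine span of `P` to that of `Q`, over `ℝ` and
over `ℚ` (that is, between the `ℚ`-affine spans of the rational points of `P` and `Q`). -/
def RatAffineEquivalent {n r : ℕ} (P : Set (Fin n → ℝ)) (Q : Set (Fin r → ℝ)) : Prop :=
  ∃ (φ : (Fin n → ℚ) →ᵃ[ℚ] (Fin r → ℚ)) (ψ : (Fin n → ℝ) →ᵃ[ℝ] (Fin r → ℝ)),
    (∀ v, ψ (ratVec v) = ratVec (φ v)) ∧ ψ '' P = Q ∧
    Set.BijOn ψ (affineSpan ℝ P) (affineSpan ℝ Q) ∧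
    Set.BijOn φ (affineSpan ℚ (ratVec ⁻¹' P)) (affineSpan ℚ (ratVec ⁻¹' Q))

end NewtonOkounkov

end

open NewtonOkounkov

namespace NewtonOkounkov

/-! The value of a monomial `g^α` is linear in `α`; it extends to `weight : ℤᵐ → ℤ × ℤʳ`. The proof
rests on the equality `latticeK` = kernel of `weight`.

One inclusion (`weight_latticeK`) holds because the two leading terms of a relation must have equal
values, or nothing could cancel the leading one. For the other (`exists_relation`, `mem_latticeK`),
two monomials of equal weight agree up to a scalar modulo higher value by one-dimensional leaves.
Subduction (`exists_aeval_eq`) rewrites the remainder as a polynomial in the Khovanskii basis whose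
monomials all have higher value, hence are smaller in the order. This gives a relation whose two
leading monomials are the prescribed ones.

The same relations show that distinct standard monomials have distinct weights, so values cannot
cancel within a normal form: if `α` is its leading exponent, the element has value `weight α`
(`value_kerLiftAlg`), while `μ` is the class of `-α`. Since `ℤᵐ → T → ℚⁿ` and `ℤᵐ → ℚ × ℚʳ` have the
same kernel, each factors through the other by a `ℚ`-linear map (`exists_ratLinearMap_comp_eq`). On
degree `i`, division by `i` puts `(i, ν'(f))` in the slice of first coordinate `1`. Restriction to
this slice, with the sign of `μ` reversed, gives rational affine maps that are mutually inverse on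
the normalized values.

For polytopality, `(i, ν'(f))` is a nonnegative integer combination of the pairs (degree, value) of
the `gⱼ`. Hence `ν'(f)/i` is a convex combination of the normalized values of the generators of
positive degree (`inv_smul_sum_mem_convexHull`); generators of degree zero contribute nothing
because `A₀ = k`. `ratAffineEquivalent_of_inverse` then transfers everything to the closed hulls. -/

/-- An integer exponent vector obtained from a monomial. -/
def intExp {m : ℕ} (α : Fin m →₀ ℕ) : Fin m → ℤ := fun i => (α i : ℤ)

theorem exists_intExp_sub {m : ℕ} (v : Fin m → ℤ) :
    ∃ α β : Fin m →₀ ℕ, v = intExp α - intExp β := by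
  refine ⟨Finsupp.equivFunOnFinite.symm fun i => (v i).toNat,
    Finsupp.equivFunOnFinite.symm fun i => (-v i).toNat, ?_⟩
  ext i
  simp only [intExp, Pi.sub_apply, Finsupp.coe_equivFunOnFinite_symm]
  omega

/-! ### Values of monomials, initial forms and subduction. -/

namespace KValuation

section

variable {k A G : Type*} [Field k] [CommRing A] [Algebra k A] [AddCommGroup G]
    [LinearOrder G] [IsOrderedAddMonoid G] (ν : KValuation k A G)

theorem nontrivial (ν : KValuation k A G) : Nontrivial A :=
  ⟨1, 0, fun h => by simpa [h] using ν.val.map_one⟩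

theorem value_mul {f h : A} (hf : f ≠ 0) (hh : h ≠ 0) :
    ν.value (f * h) = ν.value f + ν.value h := by
  have := ν.noZeroDivisors
  have h1 := ν.val.map_mul f h
  rw [ν.val_eq_value hf, ν.val_eq_value hh, ν.val_eq_value (mul_ne_zero hf hh)] at h1
  exact WithTop.coe_inj.1 h1

theorem value_one : ν.value 1 = 0 := by
  simp [value]

theorem val_smul {c : k} (hc : c ≠ 0) (f : A) : ν.val (c • f) = ν.val f := by
  rw [Algebra.smul_def, AddValuation.map_mul, ν.val_algebraMap c hc, zero_add]

/-- Elements of equal value cancel up to a scalar; a reformulation of one-dimensional leaves. -/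
def HasLeafCancellation : Prop :=
  ∀ f h : A, f ≠ 0 → h ≠ 0 → ν.value f = ν.value h → ∃ c : k, ν.val f < ν.val (f - c • h)

/-- Both classes are multiples of one vector of the leaf. The class of `h` is nonzero because its
value is exactly that of `f`, so its coefficient can be divided out. -/
theorem hasLeafCancellation_of_rank_le_one (hν : ∀ a : G, Module.rank k (ν.Leaf a) ≤ 1) :
    ν.HasLeafCancellation := by
  intro f h hf hh hfh
  have hf' : f ∈ ν.filtGE (ν.value f) := ν.value_le_val f
  have hh' : h ∈ ν.filtGE (ν.value f) := by rw [hfh]; exact ν.value_le_val h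
  obtain ⟨v, hv⟩ := rank_le_one_iff.1 (hν (ν.value f))
  obtain ⟨a, ha⟩ := hv (ν.leafMk ⟨f, hf'⟩)
  obtain ⟨b, hb⟩ := hv (ν.leafMk ⟨h, hh'⟩)
  have hb0 : b ≠ 0 := by
    rintro rfl
    rw [zero_smul, ← map_zero ν.leafMk, eq_comm, leafMk_eq, mem_filtGT] at hb
    simp only [ZeroMemClass.coe_zero, sub_zero] at hb
    rw [hfh, ν.val_eq_value hh] at hb
    exact lt_irrefl _ hb
  refine ⟨a / b, ?_⟩
  have h1 : ν.leafMk ⟨f, hf'⟩ = ν.leafMk ((a / b) • ⟨h, hh'⟩) := by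
    rw [map_smul, ← hb, ← ha, smul_smul, div_mul_cancel₀ _ hb0]
  have h2 := ν.leafMk_eq.1 h1
  rw [mem_filtGT, ← ν.val_eq_value hf] at h2
  exact h2

theorem initialForm_one : ν.initialForm 1 = 1 :=
  DirectSum.of_eq_of_gradedMonoid_eq (ν.gradedMk_eq _ _ ν.value_one rfl)

theorem initialForm_mul {f h : A} (hf : f ≠ 0) (hh : h ≠ 0) :
    ν.initialForm (f * h) = ν.initialForm f * ν.initialForm h := by
  rw [initialForm, initialForm, initialForm, DirectSum.of_mul_of]
  exact DirectSum.of_eq_of_gradedMonoid_eq (ν.gradedMk_eq _ _ (ν.value_mul hf hh) rfl)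

variable {m : ℕ} (g : Fin m → A)

/-- The monomial `g^α`. -/
noncomputable def mon (α : Fin m →₀ ℕ) : A := MvPolynomial.aeval g (MvPolynomial.monomial α (1 : k))

/-- The value of a Laurent monomial in the `gⱼ`, as a linear function of its exponent. -/
noncomputable def weight : (Fin m → ℤ) →ₗ[ℤ] G := Fintype.linearCombination ℤ fun j => ν.value (g j)

variable {g}

theorem weight_intExp_add (α β : Fin m →₀ ℕ) :
    ν.weight g (intExp (α + β)) = ν.weight g (intExp α) + ν.weight g (intExp β) := by
  rw [← map_add]
  congr 1

theorem weight_intExp_single (j : Fin m) :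
    ν.weight g (intExp (Finsupp.single j 1)) = ν.value (g j) := by
  have : intExp (Finsupp.single j 1) = Pi.single j 1 := by
    ext i
    rcases eq_or_ne j i with rfl | h
    · simp [intExp]
    · simp [intExp, h.symm]
  rw [weight, this, Fintype.linearCombination_apply_single, one_smul]

theorem mon_add (α β : Fin m →₀ ℕ) :
    mon (k := k) g (α + β) = mon (k := k) g α * mon (k := k) g β := by
  rw [mon, mon, mon, ← map_mul, MvPolynomial.monomial_mul, one_mul]

theorem mon_single (j : Fin m) : mon (k := k) g (Finsupp.single j 1) = g j := by
  rw [mon, ← MvPolynomial.X, MvPolynomial.aeval_X]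

theorem mon_zero : mon (k := k) g 0 = 1 := by
  simp [mon]

theorem mon_induction {P : (Fin m →₀ ℕ) → Prop} (zero : P 0)
    (add : ∀ j α, P α → P (Finsupp.single j 1 + α)) (α : Fin m →₀ ℕ) : P α := by
  induction α using Finsupp.induction with
  | zero => exact zero
  | single_add j n α _ hn ih =>
    clear hn
    induction n with
    | zero => simpa using ih
    | succ n hn =>
      rw [add_comm n 1, Finsupp.single_add, add_assoc]
      exact add j _ hn

theorem mon_ne_zero (ν : KValuation k A G) (hg : ∀ j, g j ≠ 0) (α : Fin m →₀ ℕ) :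
    mon (k := k) g α ≠ 0 := by
  have := ν.noZeroDivisors
  have := ν.nontrivial
  induction α using mon_induction with
  | zero => rw [mon_zero]; exact one_ne_zero
  | add j α ih => rw [mon_add, mon_single]; exact mul_ne_zero (hg j) ih

theorem value_mon (hg : ∀ j, g j ≠ 0) (α : Fin m →₀ ℕ) :
    ν.value (mon (k := k) g α) = ν.weight g (intExp α) := by
  induction α using mon_induction with
  | zero =>
    rw [mon_zero, value_one, show intExp (0 : Fin m →₀ ℕ) = 0 from rfl, map_zero]
  | add j α ih =>
    rw [mon_add, ν.value_mul (ν.mon_ne_zero hg _) (ν.mon_ne_zero hg _), ih, mon_single,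
      weight_intExp_add, weight_intExp_single]

theorem val_mon (hg : ∀ j, g j ≠ 0) (α : Fin m →₀ ℕ) :
    ν.val (mon (k := k) g α) = (ν.weight g (intExp α) : WithTop G) := by
  rw [ν.val_eq_value (ν.mon_ne_zero hg α), ν.value_mon hg]

/-- Initial forms are multiplicative on nonzero elements, as values add. This translates generation
of the associated graded algebra into statements about monomials in `A`. -/
theorem aeval_monomial_initialForm (hg : ∀ j, g j ≠ 0) (α : Fin m →₀ ℕ) :
    MvPolynomial.aeval (fun j => ν.initialForm (g j)) (MvPolynomial.monomial α (1 : k)) =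
      ν.initialForm (mon (k := k) g α) := by
  change mon (k := k) (fun j => ν.initialForm (g j)) α = _
  induction α using mon_induction with
  | zero => rw [mon_zero, mon_zero, initialForm_one]
  | add j α ih =>
    rw [mon_add, mon_add, ih, ν.initialForm_mul (ν.mon_ne_zero hg _) (ν.mon_ne_zero hg _),
      mon_single, mon_single]

theorem aeval_eq_sum {B : Type*} [CommRing B] [Algebra k B] (b : Fin m → B)
    (p : MvPolynomial (Fin m) k) :
    MvPolynomial.aeval b p = ∑ α ∈ p.support, p.coeff α • mon (k := k) b α := by
  conv_lhs => rw [p.as_sum]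
  rw [map_sum]
  refine Finset.sum_congr rfl fun α _ => ?_
  rw [mon, ← map_smul, MvPolynomial.smul_monomial, smul_eq_mul, mul_one]

theorem le_val_aeval (hg : ∀ j, g j ≠ 0) {a : G} {p : MvPolynomial (Fin m) k}
    (hp : ∀ α ∈ p.support, a ≤ ν.weight g (intExp α)) :
    (a : WithTop G) ≤ ν.val (MvPolynomial.aeval g p) := by
  rw [aeval_eq_sum]
  refine ν.val.map_le_sum fun α hα => ?_
  refine le_trans ?_ (ν.val_le_val_smul _ _)
  rw [ν.val_mon hg]
  exact WithTop.coe_le_coe.2 (hp α hα)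

theorem lt_val_aeval (hg : ∀ j, g j ≠ 0) {a : G} {p : MvPolynomial (Fin m) k}
    (hp : ∀ α ∈ p.support, a < ν.weight g (intExp α)) :
    (a : WithTop G) < ν.val (MvPolynomial.aeval g p) := by
  rw [aeval_eq_sum]
  refine ν.val.map_lt_sum WithTop.coe_ne_top fun α hα => ?_
  refine lt_of_lt_of_le ?_ (ν.val_le_val_smul _ _)
  rw [ν.val_mon hg]
  exact WithTop.coe_lt_coe.2 (hp α hα)

/-- One step of subduction. -/
theorem exists_subduction_step (hg : ν.IsKhovanskiiBasis g) (f : A) :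
    ∃ p : MvPolynomial (Fin m) k, (∀ α ∈ p.support, ν.weight g (intExp α) = ν.value f) ∧
      (ν.value f : WithTop G) < ν.val (f - MvPolynomial.aeval g p) := by
  classical
  have h1 : ν.initialForm f ∈ Algebra.adjoin k (Set.range fun j => ν.initialForm (g j)) := by
    rw [hg.2]; trivial
  rw [Algebra.adjoin_range_eq_range_aeval] at h1
  obtain ⟨q, hq⟩ := h1
  -- The initial form of `f` is homogeneous, so only the monomials of `q` in its own degree matter;
  -- the others are discarded.
  set s := q.support.filter fun α => ν.weight g (intExp α) = ν.value f with hs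
  have hmem : ∀ α ∈ s, mon (k := k) g α ∈ ν.filtGE (ν.value f) := by
    intro α hα
    rw [mem_filtGE, ν.val_mon hg.1, (Finset.mem_filter.1 hα).2]
  refine ⟨∑ α ∈ s, MvPolynomial.monomial α (q.coeff α), ?_, ?_⟩
  · intro α hα
    have h2 := MvPolynomial.support_sum hα
    obtain ⟨β, hβ, hα'⟩ := Finset.mem_biUnion.1 h2
    have := Finset.mem_singleton.1 (MvPolynomial.support_monomial_subset hα')
    subst this
    exact (Finset.mem_filter.1 hβ).2
  · have h2 : ν.leafMk ⟨f, ν.value_le_val f⟩ =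
        ν.leafMk (∑ α ∈ s.attach, q.coeff α.1 • ⟨mon (k := k) g α.1, hmem α.1 α.2⟩) := by
      have h3 : (ν.initialForm f) (ν.value f) = ν.leafMk ⟨f, ν.value_le_val f⟩ :=
        DirectSum.of_eq_same _ _
      rw [← h3, ← hq]
      change (MvPolynomial.aeval (fun j => ν.initialForm (g j)) q : ν.Gr) (ν.value f) = _
      -- Take the component of degree `ν.value f`: monomials of another weight have zero component
      -- there.
      rw [aeval_eq_sum, DFinsupp.finsetSum_apply, map_sum,
        ← Finset.sum_filter_of_ne (p := fun α => ν.weight g (intExp α) = ν.value f),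
        ← hs, ← Finset.sum_attach]
      · refine Finset.sum_congr rfl fun α _ => ?_
        rw [map_smul]
        rw [show (mon (k := k) (fun j => ν.initialForm (g j)) α.1 : ν.Gr) =
          ν.initialForm (mon (k := k) g α.1) from ν.aeval_monomial_initialForm hg.1 α.1]
        change q.coeff α.1 • (ν.initialForm (mon (k := k) g α.1)) (ν.value f) = _
        congr 1
        have h5 : ν.initialForm (mon (k := k) g α.1) = DirectSum.of ν.Leaf (ν.value f)
            (ν.leafMk ⟨mon (k := k) g α.1, hmem α.1 α.2⟩) :=
          DirectSum.of_eq_of_gradedMonoid_eq (ν.gradedMk_eq _ _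
            ((ν.value_mon hg.1 _).trans (Finset.mem_filter.1 α.2).2) rfl)
        rw [h5]
        exact DirectSum.of_eq_same _ _
      · intro α _ hne
        by_contra hα
        apply hne
        rw [show (mon (k := k) (fun j => ν.initialForm (g j)) α : ν.Gr) =
          ν.initialForm (mon (k := k) g α) from ν.aeval_monomial_initialForm hg.1 α]
        change q.coeff α • (ν.initialForm (mon (k := k) g α)) (ν.value f) = 0
        rw [initialForm, DirectSum.of_eq_of_ne, smul_zero]
        rw [ν.value_mon hg.1]
        exact Ne.symm hα
    have h3 := ν.leafMk_eq.1 h2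
    rw [mem_filtGT] at h3
    convert h3 using 3
    rw [map_sum, AddSubmonoidClass.coe_finsetSum, ← Finset.sum_attach]
    refine Finset.sum_congr rfl fun α _ => ?_
    change _ = q.coeff α.1 • mon (k := k) g α.1
    rw [mon, ← map_smul, MvPolynomial.smul_monomial, smul_eq_mul, mul_one]

/-- Subduction: every element is a polynomial in a Khovanskii basis, without cancellation of
values. -/
theorem exists_aeval_eq (hν : ν.valueSet.WellFoundedOn (· > ·)) (hg : ν.IsKhovanskiiBasis g)
    (f : A) : ∃ p : MvPolynomial (Fin m) k, MvPolynomial.aeval g p = f ∧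
      ∀ α ∈ p.support, ν.val f ≤ (ν.weight g (intExp α) : WithTop G) := by
  classical
  rcases eq_or_ne f 0 with rfl | hf
  · exact ⟨0, by simp, by simp⟩
  obtain ⟨a, ha⟩ : ∃ a : ν.valueSet, a.1 = ν.value f := ⟨⟨_, f, hf, rfl⟩, rfl⟩
  have hwf : WellFounded fun a b : ν.valueSet => a.1 > b.1 := hν
  -- Each subduction step strictly raises the value of the remainder, and such a chain must stop
  -- because nonempty sets of values have maxima.
  induction a using hwf.induction generalizing f with
  | _ a ih =>
    obtain ⟨p, hp, hlt⟩ := ν.exists_subduction_step hg f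
    have hval := ν.val_eq_value hf
    rcases eq_or_ne (f - MvPolynomial.aeval g p) 0 with h0 | h0
    · exact ⟨p, (sub_eq_zero.1 h0).symm, fun α hα => by rw [hp α hα, hval]⟩
    · rw [ν.val_eq_value h0, WithTop.coe_lt_coe] at hlt
      obtain ⟨q, hq, hq'⟩ := ih ⟨_, _, h0, rfl⟩ (by rw [ha]; exact hlt) _ h0 rfl
      refine ⟨p + q, by rw [map_add, hq]; ring, fun α hα => ?_⟩
      rcases Finset.mem_union.1 (MvPolynomial.support_add hα) with h | h
      · rw [hp α h, hval]
      · refine le_trans ?_ (hq' α h)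
        rw [hval, ν.val_eq_value h0]
        exact WithTop.coe_le_coe.2 hlt.le

end

end KValuation

/-! ### Relations, the lattice of toric exponents, and standard monomials. -/

namespace KValuation

section

variable {k A G : Type*} [Field k] [CommRing A] [Algebra k A] [AddCommGroup G]
    [LinearOrder G] [IsOrderedAddMonoid G] (ν : KValuation k A G) {m : ℕ} {g : Fin m → A}
    {tie ord : MonomialOrder (Fin m)}

variable {ν}

/-- The induced order reverses values: leading monomials are those of least value. -/
theorem toSyn_lt_of_weight_lt (hg : ∀ j, g j ≠ 0) (hord : IsInducedOrder ν g tie ord)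
    {α β : Fin m →₀ ℕ} (h : ν.weight g (intExp α) < ν.weight g (intExp β)) :
    ord.toSyn β < ord.toSyn α := by
  refine (hord α β).2 (Or.inl ?_)
  rw [← mon, ← mon, ν.val_mon hg, ν.val_mon hg]
  exact WithTop.coe_lt_coe.2 h

theorem weight_le_of_toSyn_le (hg : ∀ j, g j ≠ 0) (hord : IsInducedOrder ν g tie ord)
    {α β : Fin m →₀ ℕ} (h : ord.toSyn β ≤ ord.toSyn α) :
    ν.weight g (intExp α) ≤ ν.weight g (intExp β) := by
  by_contra! hlt
  exact (toSyn_lt_of_weight_lt hg hord hlt).not_ge h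

theorem aeval_leadingTerm (f : MvPolynomial (Fin m) k) :
    MvPolynomial.aeval g (ord.leadingTerm f) =
      ord.leadingCoeff f • mon (k := k) g (ord.degree f) := by
  rw [MonomialOrder.leadingTerm, mon, ← map_smul, MvPolynomial.smul_monomial, smul_eq_mul, mul_one]

theorem val_aeval_leadingTerm (hg : ∀ j, g j ≠ 0) {f : MvPolynomial (Fin m) k} (hf : f ≠ 0) :
    ν.val (MvPolynomial.aeval g (ord.leadingTerm f)) =
      (ν.weight g (intExp (ord.degree f)) : WithTop G) := by
  rw [aeval_leadingTerm, ν.val_smul (MonomialOrder.leadingCoeff_ne_zero_iff.2 hf), ν.val_mon hg]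

/-- The two leading monomials of a relation have the same weight. -/
theorem weight_toricExponent (hg : ∀ j, g j ≠ 0) (hord : IsInducedOrder ν g tie ord)
    {f : MvPolynomial (Fin m) k} (hf : MvPolynomial.aeval g f = 0) (h0 : f ≠ 0)
    : ν.weight g (toricExponent ord f) = 0 := by
  have h2 : toricExponent ord f = intExp (ord.degree f) - intExp (ord.degree (ord.subLTerm f)) :=
    rfl
  rw [h2, map_sub, sub_eq_zero]
  have hle := weight_le_of_toSyn_le hg hord (ord.degree_sub_leadingTerm_le f)
  -- If the weight jumped strictly after the leading monomial, the tail would have value above that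
  -- of the leading term, yet in `A` it is the negative of that term.
  refine hle.antisymm (not_lt.1 fun hlt => ?_)
  have h3 : ((ν.weight g (intExp (ord.degree (ord.subLTerm f))) : G) : WithTop G) ≤
      ν.val (MvPolynomial.aeval g (ord.subLTerm f)) :=
    ν.le_val_aeval hg fun α hα => weight_le_of_toSyn_le hg hord (ord.le_degree hα)
  have h4 : MvPolynomial.aeval g (ord.subLTerm f) =
      - MvPolynomial.aeval g (ord.leadingTerm f) := by
    rw [MonomialOrder.subLTerm, map_sub, hf, zero_sub, MonomialOrder.leadingTerm]
  rw [h4, AddValuation.map_neg, val_aeval_leadingTerm hg h0, WithTop.coe_le_coe] at h3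
  exact h3.not_gt hlt

theorem weight_latticeK (hg : ∀ j, g j ≠ 0) (hord : IsInducedOrder ν g tie ord)
    {v : Fin m → ℤ} (hv : v ∈ latticeK ord (RingHom.ker (MvPolynomial.aeval (R := k) g))) :
    ν.weight g v = 0 := by
  suffices latticeK ord (RingHom.ker (MvPolynomial.aeval (R := k) g)) ≤
    LinearMap.ker (ν.weight g) from this hv
  rw [latticeK, Submodule.span_le]
  rintro _ ⟨f, hf, h0, -, rfl⟩
  exact weight_toricExponent hg hord hf h0

/-- The relation is `x^α - c x^β - p`, where `c` cancels the common value and `p` is a subduction of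
what remains. Every monomial of `p` has weight above the common one, so it lies below `x^β` in the
order. -/
theorem exists_relation (hν : ν.valueSet.WellFoundedOn (· > ·)) (hl : ν.HasLeafCancellation)
    (hg : ν.IsKhovanskiiBasis g) (hord : IsInducedOrder ν g tie ord) {α β : Fin m →₀ ℕ}
    (hαβ : ord.toSyn β < ord.toSyn α) (hw : ν.weight g (intExp α) = ν.weight g (intExp β)) :
    ∃ f : MvPolynomial (Fin m) k, MvPolynomial.aeval g f = 0 ∧ f ≠ 0 ∧ ord.subLTerm f ≠ 0 ∧
      ord.degree f = α ∧ ord.degree (ord.subLTerm f) = β := by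
  classical
  obtain ⟨c, hc⟩ := hl (mon (k := k) g α) (mon (k := k) g β) (ν.mon_ne_zero hg.1 _)
    (ν.mon_ne_zero hg.1 _) (by rw [ν.value_mon hg.1, ν.value_mon hg.1, hw])
  -- With `c = 0` the strict inequality `hc` would compare a value with itself.
  have hc0 : c ≠ 0 := by
    rintro rfl
    simp at hc
  obtain ⟨p, hp, hp'⟩ := ν.exists_aeval_eq hν hg (mon (k := k) g α - c • mon (k := k) g β)
  set t : MvPolynomial (Fin m) k := MvPolynomial.monomial β c with ht
  have ht0 : t ≠ 0 := by rw [ht, Ne, MvPolynomial.monomial_eq_zero]; exact hc0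
  have hdt : ord.degree t = β := by rw [ht, ord.degree_monomial, if_neg hc0]
  have hplt : p ≠ 0 → ord.toSyn (ord.degree p) < ord.toSyn β := by
    intro hp0
    refine toSyn_lt_of_weight_lt hg.1 hord ?_
    have h1 := hc.trans_le (hp' _ (ord.degree_mem_support hp0))
    rw [ν.val_mon hg.1, WithTop.coe_lt_coe, hw] at h1
    exact h1
  have hd : ord.degree (t + p) = β := by
    rcases eq_or_ne p 0 with rfl | hp0
    · rw [add_zero, hdt]
    · rw [ord.degree_add_of_lt (by rw [hdt]; exact hplt hp0), hdt]
  have htp : t + p ≠ 0 := by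
    rcases eq_or_ne p 0 with rfl | hp0
    · rwa [add_zero]
    · intro h0
      have h1 := ord.leadingCoeff_add_of_lt (f := t) (g := p) (by rw [hdt]; exact hplt hp0)
      rw [h0, MonomialOrder.leadingCoeff_zero, eq_comm, MonomialOrder.leadingCoeff_eq_zero_iff] at h1
      exact ht0 h1
  have hα : ord.degree (MvPolynomial.monomial α (1 : k)) = α := by
    rw [ord.degree_monomial, if_neg one_ne_zero]
  have hlt : ord.toSyn (ord.degree (t + p)) <
      ord.toSyn (ord.degree (MvPolynomial.monomial α (1 : k))) := by rwa [hd, hα]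
  have hdf : ord.degree (MvPolynomial.monomial α (1 : k) - (t + p)) = α := by
    rw [ord.degree_sub_of_lt hlt, hα]
  have hlf : ord.leadingCoeff (MvPolynomial.monomial α (1 : k) - (t + p)) = 1 := by
    rw [ord.leadingCoeff_sub_of_lt hlt, ord.leadingCoeff_monomial]
  have hsub : ord.subLTerm (MvPolynomial.monomial α (1 : k) - (t + p)) = -(t + p) := by
    rw [MonomialOrder.subLTerm, hdf, hlf]
    ring
  refine ⟨MvPolynomial.monomial α (1 : k) - (t + p), ?_, ?_, ?_, hdf, ?_⟩
  · have h1 : MvPolynomial.aeval g t = c • mon (k := k) g β := by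
      rw [ht, mon, ← map_smul, MvPolynomial.smul_monomial, smul_eq_mul, mul_one]
    rw [map_sub, map_add, hp, h1, ← mon]
    ring
  · intro h0
    rw [h0, MonomialOrder.leadingCoeff_zero] at hlf
    exact zero_ne_one hlf
  · rw [hsub]; exact neg_ne_zero.2 htp
  · rw [hsub, ord.degree_neg, hd]

/-- Write the vector as a difference of two exponents of equal weight; up to sign it is the toric
exponent of the relation with those leading monomials. -/
theorem mem_latticeK (hν : ν.valueSet.WellFoundedOn (· > ·)) (hl : ν.HasLeafCancellation)
    (hg : ν.IsKhovanskiiBasis g) (hord : IsInducedOrder ν g tie ord) {v : Fin m → ℤ}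
    (hv : ν.weight g v = 0) :
    v ∈ latticeK ord (RingHom.ker (MvPolynomial.aeval (R := k) g)) := by
  obtain ⟨α, β, rfl⟩ := exists_intExp_sub v
  rw [map_sub, sub_eq_zero] at hv
  have key : ∀ α β : Fin m →₀ ℕ, ord.toSyn β < ord.toSyn α →
      ν.weight g (intExp α) = ν.weight g (intExp β) →
      intExp α - intExp β ∈ latticeK ord (RingHom.ker (MvPolynomial.aeval (R := k) g)) := by
    intro α β hlt hw
    obtain ⟨f, hf, h0, h1, rfl, rfl⟩ := exists_relation hν hl hg hord hlt hw
    exact Submodule.subset_span ⟨f, hf, h0, h1, rfl⟩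
  rcases lt_trichotomy (ord.toSyn β) (ord.toSyn α) with h | h | h
  · exact key α β h hv
  · rw [ord.toSyn.injective h, sub_self]
    exact zero_mem _
  · rw [← neg_sub]
    exact neg_mem (key β α h hv.symm)

theorem not_isStandard_degree {I : Ideal (MvPolynomial (Fin m) k)} {f : MvPolynomial (Fin m) k}
    (hf : f ∈ I) (h0 : f ≠ 0) : ¬ IsStandard ord I (ord.degree f) := by
  rw [IsStandard, not_not]
  have : MvPolynomial.monomial (ord.degree f) (1 : k) =
      MvPolynomial.C (ord.leadingCoeff f)⁻¹ * ord.leadingTerm f := by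
    rw [MonomialOrder.leadingTerm, MvPolynomial.C_mul_monomial,
      inv_mul_cancel₀ (MonomialOrder.leadingCoeff_ne_zero_iff.2 h0)]
  rw [this]
  exact Ideal.mul_mem_left _ _ (Ideal.subset_span ⟨f, hf, rfl⟩)

/-- If two different monomials had the same weight, the larger would lead a relation and so could
not be standard. -/
theorem isStandard_weight_injective (hν : ν.valueSet.WellFoundedOn (· > ·))
    (hl : ν.HasLeafCancellation) (hg : ν.IsKhovanskiiBasis g)
    (hord : IsInducedOrder ν g tie ord) {α β : Fin m →₀ ℕ}
    (hα : IsStandard ord (RingHom.ker (MvPolynomial.aeval (R := k) g)) α)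
    (hβ : IsStandard ord (RingHom.ker (MvPolynomial.aeval (R := k) g)) β)
    (hw : ν.weight g (intExp α) = ν.weight g (intExp β)) : α = β := by
  rcases lt_trichotomy (ord.toSyn β) (ord.toSyn α) with h | h | h
  · obtain ⟨f, hf, h0, -, rfl, -⟩ := exists_relation hν hl hg hord h hw
    exact absurd hα (not_isStandard_degree hf h0)
  · exact (ord.toSyn.injective h).symm
  · obtain ⟨f, hf, h0, -, rfl, -⟩ := exists_relation hν hl hg hord h hw.symm
    exact absurd hβ (not_isStandard_degree hf h0)

/-- The value of an element is the weight of the leading monomial of its normal form. -/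
theorem value_kerLiftAlg (hν : ν.valueSet.WellFoundedOn (· > ·))
    (hl : ν.HasLeafCancellation) (hg : ν.IsKhovanskiiBasis g)
    (hord : IsInducedOrder ν g tie ord)
    {q : MvPolynomial (Fin m) k ⧸ RingHom.ker (MvPolynomial.aeval (R := k) g)} (hq : q ≠ 0) :
    ν.value (Ideal.kerLiftAlg (MvPolynomial.aeval (R := k) g) q) =
      ν.weight g (intExp (ord.degree (normalForm ord _ q))) := by
  classical
  have hspec := (existsUnique_normalForm ord _ q).choose_spec.1
  change Ideal.Quotient.mk _ (normalForm ord _ q) = q ∧ ∀ α ∈ (normalForm ord _ q).support,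
    IsStandard ord _ α at hspec
  set f := normalForm ord _ q with hf
  clear_value f
  obtain ⟨rfl, hst⟩ := hspec
  have h0 : f ≠ 0 := by
    rintro rfl
    exact hq (map_zero _)
  rw [Ideal.kerLiftAlg_mk]
  have hsplit : f = ord.leadingTerm f + ord.subLTerm f := by
    rw [MonomialOrder.subLTerm, MonomialOrder.leadingTerm]; ring
  have hrest : ((ν.weight g (intExp (ord.degree f)) : G) : WithTop G) <
      ν.val (MvPolynomial.aeval g (ord.subLTerm f)) := by
    refine ν.lt_val_aeval hg.1 fun α hα => ?_
    have hne : α ≠ ord.degree f := by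
      rintro rfl
      rw [MvPolynomial.mem_support_iff, MonomialOrder.subLTerm,
        MvPolynomial.coeff_sub, MvPolynomial.coeff_monomial, if_pos rfl] at hα
      exact hα (sub_self (ord.leadingCoeff f))
    have hmem : α ∈ f.support := by
      rw [MvPolynomial.mem_support_iff, MonomialOrder.subLTerm,
        MvPolynomial.coeff_sub, MvPolynomial.coeff_monomial, if_neg hne.symm, sub_zero] at hα
      exact MvPolynomial.mem_support_iff.2 hα
    -- The order gives only a weak inequality of weights; standardness of both monomials makes it
    -- strict.
    refine (weight_le_of_toSyn_le hg.1 hord (ord.le_degree hmem)).lt_of_ne fun heq => hne ?_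
    exact isStandard_weight_injective hν hl hg hord (hst _ hmem)
      (hst _ (ord.degree_mem_support h0)) heq.symm
  have h1 : ν.val (MvPolynomial.aeval g f) =
      (ν.weight g (intExp (ord.degree f)) : WithTop G) := by
    have h2 := congrArg (MvPolynomial.aeval g) hsplit
    rw [map_add] at h2
    rw [h2, AddValuation.map_add_eq_of_lt_left, val_aeval_leadingTerm hg.1 h0]
    rwa [val_aeval_leadingTerm hg.1 h0]
  rw [value, h1, WithTop.untopD_coe]

end

/-! ### Transfer of the standing hypotheses from `ν'` to the induced valuation. -/

section

variable {k A' Γ : Type*} [Field k] [CommRing A'] [Algebra k A'] [AddCommGroup Γ]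
    [LinearOrder Γ] [IsOrderedAddMonoid Γ] {ν' : KValuation k A' Γ}
    (𝒜 : ℕ → Submodule k A') [SetLike.GradedMonoid 𝒜]

theorem toPoly_ne_zero {f : ⨁ i, 𝒜 i} (hf : f ≠ 0) : toPoly 𝒜 f ≠ 0 := by
  rwa [Ne, map_eq_zero_iff _ (toPoly_injective 𝒜)]

theorem induced_value_eq {f : ⨁ i, 𝒜 i} (hf : f ≠ 0) :
    (ν'.induced 𝒜).value f = toLex (OrderDual.toDual ((toPoly 𝒜 f).natDegree : ℤ),
      ν'.value (toPoly 𝒜 f).leadingCoeff) := by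
  change (ν'.polyVal (toPoly 𝒜 f)).untopD 0 = _
  rw [ν'.polyVal_of_ne_zero (toPoly_ne_zero 𝒜 hf), WithTop.untopD_coe]

theorem induced_value_of {i : ℕ} {f : 𝒜 i} (hf : f ≠ 0) :
    (ν'.induced 𝒜).value (DirectSum.of (fun i => 𝒜 i) i f) =
      toLex (OrderDual.toDual (i : ℤ), ν'.value (f : A')) := by
  have h := ν'.induced_value 𝒜 (f := DirectSum.of (fun i => 𝒜 i) i f) (n := i)
    (by rwa [DirectSum.of_eq_same])
    (fun j hj => DirectSum.of_eq_of_ne _ _ _ hj.ne')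
  rwa [DirectSum.of_eq_same] at h

/-- Equal induced values mean equal top degrees and equal values of the top coefficients, so the
scalar that cancels these coefficients for `ν'` works. -/
theorem hasLeafCancellation_induced (hl : ν'.HasLeafCancellation) :
    (ν'.induced 𝒜).HasLeafCancellation := by
  intro f h hf hh hfh
  have hp := toPoly_ne_zero 𝒜 hf
  have hq := toPoly_ne_zero 𝒜 hh
  rw [induced_value_eq 𝒜 hf, induced_value_eq 𝒜 hh] at hfh
  obtain ⟨hdeg, hval⟩ := Prod.mk.inj (toLex.injective hfh)
  have hdeg' : (toPoly 𝒜 f).natDegree = (toPoly 𝒜 h).natDegree :=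
    Nat.cast_injective (R := ℤ) (OrderDual.toDual.injective hdeg)
  have hlc : (toPoly 𝒜 f).leadingCoeff ≠ 0 := by simpa using hp
  obtain ⟨c, hc⟩ := hl _ _ hlc (by simpa using hq) hval
  refine ⟨c, ?_⟩
  change ν'.polyVal (toPoly 𝒜 f) < ν'.polyVal (toPoly 𝒜 (f - c • h))
  rw [map_sub, map_smul]
  set p := toPoly 𝒜 f with hpdef
  set q := toPoly 𝒜 h with hqdef
  have hcoeff : (p - c • q).coeff p.natDegree = p.leadingCoeff - c • q.leadingCoeff := by
    rw [Polynomial.coeff_sub, Polynomial.coeff_smul, Polynomial.leadingCoeff,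
      Polynomial.leadingCoeff, hdeg']
  refine lt_of_le_of_ne ?_ fun heq => ?_
  · rw [ν'.polyVal_of_ne_zero hp, le_polyVal_iff, hcoeff, ← ν'.val_eq_value hlc]
    refine ⟨(Polynomial.natDegree_sub_le _ _).trans (max_le le_rfl ?_), hc.le⟩
    exact (Polynomial.natDegree_smul_le _ _).trans hdeg'.ge
  -- Equality of values would leave the degree and the value of the top coefficient unchanged,
  -- contrary to the choice of `c`.
  · have h0 : p - c • q ≠ 0 := by
      intro h0
      rw [h0, ν'.polyVal_zero, ν'.polyVal_of_ne_zero hp] at heq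
      exact WithTop.coe_ne_top heq
    rw [ν'.polyVal_of_ne_zero hp, ν'.polyVal_of_ne_zero h0, WithTop.coe_inj] at heq
    obtain ⟨h1, h2⟩ := Prod.mk.inj (toLex.injective heq)
    have h1' : p.natDegree = (p - c • q).natDegree :=
      Nat.cast_injective (R := ℤ) (OrderDual.toDual.injective h1)
    have h3 : (p - c • q).leadingCoeff = p.leadingCoeff - c • q.leadingCoeff := by
      rw [← hcoeff, h1', Polynomial.leadingCoeff]
    have h4 : p.leadingCoeff - c • q.leadingCoeff ≠ 0 := by
      rw [← h3]; simpa using h0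
    rw [ν'.val_eq_value hlc, ν'.val_eq_value h4, WithTop.coe_lt_coe, ← h3, ← h2] at hc
    exact lt_irrefl _ hc

/-- The degree coordinate is order-reversed, so raising the value lowers the degree in `ℕ`, or keeps
it and raises the `ν'`-value. This is a lexicographic product of two well-founded relations. -/
theorem wellFoundedOn_valueSet_induced (hν : ν'.valueSet.WellFoundedOn (· > ·)) :
    (ν'.induced 𝒜).valueSet.WellFoundedOn (· > ·) := by
  have hwf : WellFounded (Prod.Lex (fun a b : ℕ => a < b)
      (fun a b : ν'.valueSet => a.1 > b.1)) := WellFounded.prod_lex wellFounded_lt hν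
  have hex : ∀ a : (ν'.induced 𝒜).valueSet, ∃ x : ℕ × ν'.valueSet,
      a.1 = toLex (OrderDual.toDual (x.1 : ℤ), x.2.1) := by
    rintro ⟨_, f, hf, rfl⟩
    exact ⟨⟨_, _, _, by simpa using toPoly_ne_zero 𝒜 hf, rfl⟩, induced_value_eq 𝒜 hf⟩
  choose φ hφ using hex
  refine Subrelation.wf (fun {a b} hab => ?_) (InvImage.wf φ hwf)
  have hab' : b.1 < a.1 := hab
  rw [hφ a, hφ b, Prod.Lex.lt_iff] at hab'
  simp only [ofLex_toLex, OrderDual.toDual_lt_toDual, Nat.cast_lt,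
    OrderDual.toDual_inj, Nat.cast_inj] at hab'
  rw [InvImage, Prod.lex_iff]
  rcases hab' with h | ⟨h, h'⟩
  · exact Or.inl h
  · exact Or.inr ⟨h.symm, h'⟩

end

end KValuation

/-! ### Rational affine maps and polytopes -/

theorem ratVec_injective {n : ℕ} : Function.Injective (ratVec (n := n)) := fun _ _ h =>
  funext fun j => Rat.cast_injective (α := ℝ) (congrFun h j)

/-- Two additive maps to rational vector spaces with comparable kernels factor through each other. -/
theorem exists_ratLinearMap_comp_eq {X V U : Type*} [AddCommGroup X] [AddCommGroup V] [Module ℚ V]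
    [AddCommGroup U] [Module ℚ U] (a : X →ₗ[ℤ] V) (b : X →ₗ[ℤ] U)
    (hab : ∀ x, a x = 0 → b x = 0) : ∃ L : V →ₗ[ℚ] U, ∀ x, L (a x) = b x := by
  let _ : DivisibleBy U ℤ :=
    { div := fun u n => (n : ℚ)⁻¹ • u
      div_zero := by simp
      div_cancel := by
        intro n u hn
        rw [← Int.cast_smul_eq_zsmul ℚ, smul_smul, mul_inv_cancel₀ (Int.cast_ne_zero.2 hn),
          one_smul] }
  have hker : LinearMap.ker a ≤ LinearMap.ker b := fun x hx => hab x hx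
  -- `U` is divisible, hence an injective `ℤ`-module, so the map induced by `b` on `X / ker a`,
  -- which embeds in `V`, extends to `V`.
  obtain ⟨h, hh⟩ := (Module.Baer.of_divisible U).extension_property
    ((LinearMap.ker a).liftQ a le_rfl)
    (LinearMap.ker_eq_bot.1 (Submodule.ker_liftQ_eq_bot _ _ _ le_rfl))
    ((LinearMap.ker a).liftQ b hker)
  -- Additive maps between rational vector spaces are automatically `ℚ`-linear.
  refine ⟨h.toAddMonoidHom.toRatLinearMap, fun x => ?_⟩
  exact LinearMap.congr_fun hh (Submodule.Quotient.mk x)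

/-- A rational affine map extends to a real one. -/
theorem exists_real_extension {n r : ℕ} (φ : (Fin n → ℚ) →ᵃ[ℚ] (Fin r → ℚ)) :
    ∃ Φ : (Fin n → ℝ) →ᵃ[ℝ] (Fin r → ℝ), ∀ v, Φ (ratVec v) = ratVec (φ v) := by
  obtain ⟨M, hM⟩ : ∃ M : Matrix (Fin r) (Fin n) ℚ, ∀ v, φ v = M.mulVec v + φ 0 := by
    refine ⟨LinearMap.toMatrix' φ.linear, fun v => ?_⟩
    rw [← Matrix.toLin'_apply, Matrix.toLin'_toMatrix']
    exact congrFun φ.decomp v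
  refine ⟨(Matrix.toLin' (M.map ((↑) : ℚ → ℝ))).toAffineMap +
    AffineMap.const ℝ _ (ratVec (φ 0)), fun v => ?_⟩
  ext j
  rw [hM v]
  simp [ratVec, Matrix.mulVec, dotProduct]

theorem eqOn_affineSpan {K E F : Type*} [Ring K] [AddCommGroup E] [Module K E] [AddCommGroup F]
    [Module K F] {f g : E →ᵃ[K] F} {s : Set E} (h : Set.EqOn f g s) :
    Set.EqOn f g (affineSpan K s) := by
  intro x hx
  refine affineSpan_induction (p := fun x => f x = g x) hx (fun x hx => h hx) ?_
  intro c u v w hu hv hw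
  simp only [AffineMap.map_vadd, LinearMap.map_smul, AffineMap.linearMap_vsub, hu, hv, hw]

theorem bijOn_affineSpan {K E F : Type*} [Ring K] [AddCommGroup E] [Module K E] [AddCommGroup F]
    [Module K F] {φ : E →ᵃ[K] F} {ψ : F →ᵃ[K] E} {s : Set E} {t : Set F}
    (hφ : Set.MapsTo φ s t) (hψ : Set.MapsTo ψ t s) (hl : Set.LeftInvOn ψ φ s)
    (hr : Set.LeftInvOn φ ψ t) : Set.BijOn φ (affineSpan K s) (affineSpan K t) := by
  refine Set.InvOn.bijOn (f' := ψ) ⟨?_, ?_⟩ ?_ ?_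
  · exact eqOn_affineSpan (f := ψ.comp φ) (g := AffineMap.id K E) hl
  · exact eqOn_affineSpan (f := φ.comp ψ) (g := AffineMap.id K F) hr
  · intro x hx
    have := AffineSubspace.mem_map_of_mem φ hx
    rw [AffineSubspace.map_span] at this
    exact affineSpan_mono K hφ.image_subset this
  · intro x hx
    have := AffineSubspace.mem_map_of_mem ψ hx
    rw [AffineSubspace.map_span] at this
    exact affineSpan_mono K hψ.image_subset this

/-- The hull of a finite set is already closed, so once finitely many points of `s` span its hull
the closure adds nothing. -/
theorem closure_convexHull_eq {E : Type*} [AddCommGroup E] [Module ℝ E] [TopologicalSpace E]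
    [IsTopologicalAddGroup E] [ContinuousSMul ℝ E] [T2Space E] {s t : Set E} (ht : t.Finite)
    (hts : t ⊆ s) (hst : s ⊆ convexHull ℝ t) : closure (convexHull ℝ s) = convexHull ℝ t := by
  have : convexHull ℝ s = convexHull ℝ t :=
    (convexHull_min hst (convex_convexHull ℝ t)).antisymm (convexHull_mono hts)
  rw [this, (ht.isClosed_convexHull (𝕜 := ℝ)).closure_eq]

/-- Mutually inverse rational affine maps between two sets of rational points, one of which is
spanned by finitely many of its points, identify the closed convex hulls. -/
theorem ratAffineEquivalent_of_inverse {n r : ℕ} {s : Set (Fin n → ℚ)} {t V : Set (Fin r → ℚ)}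
    (hV : V.Finite) (hVt : V ⊆ t) (htV : ratVec '' t ⊆ convexHull ℝ (ratVec '' V))
    (φ : (Fin n → ℚ) →ᵃ[ℚ] (Fin r → ℚ)) (ψ : (Fin r → ℚ) →ᵃ[ℚ] (Fin n → ℚ))
    (hφ : Set.MapsTo φ s t) (hψ : Set.MapsTo ψ t s) (hl : Set.LeftInvOn ψ φ s)
    (hr : Set.LeftInvOn φ ψ t) :
    IsRationalPolytope (closure (convexHull ℝ (ratVec '' t))) ∧
    IsRationalPolytope (closure (convexHull ℝ (ratVec '' s))) ∧
    RatAffineEquivalent (closure (convexHull ℝ (ratVec '' s)))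
      (closure (convexHull ℝ (ratVec '' t))) := by
  classical
  obtain ⟨Φ, hΦ⟩ := exists_real_extension φ
  obtain ⟨Ψ, hΨ⟩ := exists_real_extension ψ
  have hΨV : Ψ '' (ratVec '' V) = ratVec '' (ψ '' V) := by
    simp only [Set.image_image, hΨ]
  have hWs : ψ '' V ⊆ s := (hψ.mono_left hVt).image_subset
  have hsW : ratVec '' s ⊆ convexHull ℝ (ratVec '' (ψ '' V)) := by
    rintro _ ⟨x, hx, rfl⟩
    -- Since `x = ψ (φ x)` and `φ x` lies in the hull of `V`, the point `x` lies in the image of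
    -- that hull under `Ψ`.
    rw [← hΨV, ← AffineMap.image_convexHull, ← hl hx, ← hΨ]
    exact Set.mem_image_of_mem _ (htV ⟨_, hφ hx, rfl⟩)
  rw [closure_convexHull_eq (hV.image _) (Set.image_mono hVt) htV,
    closure_convexHull_eq ((hV.image _).image _) (Set.image_mono hWs) hsW]
  have hΦW : Φ '' (ratVec '' (ψ '' V)) = ratVec '' V := by
    simp only [Set.image_image, hΦ]
    exact Set.image_congr fun x hx => by rw [hr (hVt hx)]
  have hPQ : Φ '' convexHull ℝ (ratVec '' (ψ '' V)) = convexHull ℝ (ratVec '' V) := by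
    rw [AffineMap.image_convexHull, hΦW]
  have hQP : Ψ '' convexHull ℝ (ratVec '' V) = convexHull ℝ (ratVec '' (ψ '' V)) := by
    rw [AffineMap.image_convexHull, hΨV]
  have hmP : Set.MapsTo Φ (convexHull ℝ (ratVec '' (ψ '' V))) (convexHull ℝ (ratVec '' V)) :=
    fun x hx => hPQ ▸ Set.mem_image_of_mem _ hx
  have hmQ : Set.MapsTo Ψ (convexHull ℝ (ratVec '' V)) (convexHull ℝ (ratVec '' (ψ '' V))) :=
    fun x hx => hQP ▸ Set.mem_image_of_mem _ hx
  -- The composite is affine and fixes the spanning points, hence fixes their whole affine span.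
  have hL : Set.LeftInvOn Ψ Φ (convexHull ℝ (ratVec '' (ψ '' V))) := by
    intro x hx
    refine eqOn_affineSpan (f := Ψ.comp Φ) (g := AffineMap.id ℝ _) ?_
      (convexHull_subset_affineSpan _ hx)
    rintro _ ⟨_, ⟨y, hy, rfl⟩, rfl⟩
    simp [hΦ, hΨ, hr (hVt hy)]
  have hR : Set.LeftInvOn Φ Ψ (convexHull ℝ (ratVec '' V)) := by
    intro x hx
    refine eqOn_affineSpan (f := Φ.comp Ψ) (g := AffineMap.id ℝ _) ?_
      (convexHull_subset_affineSpan _ hx)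
    rintro _ ⟨y, hy, rfl⟩
    simp [hΦ, hΨ, hr (hVt hy)]
  refine ⟨⟨hV.toFinset, by simp⟩, ⟨(hV.image ψ).toFinset, by simp⟩, φ, Φ, hΦ, hPQ,
    bijOn_affineSpan hmP hmQ hL hR, bijOn_affineSpan (ψ := ψ) ?_ ?_ ?_ ?_⟩
  · intro x hx
    have := hmP (Set.mem_preimage.1 hx)
    rwa [hΦ] at this
  · intro x hx
    have := hmQ (Set.mem_preimage.1 hx)
    rwa [hΨ] at this
  · intro x hx
    have := hL (Set.mem_preimage.1 hx)
    rw [hΦ, hΨ] at this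
    exact ratVec_injective this
  · intro x hx
    have := hR (Set.mem_preimage.1 hx)
    rw [hΨ, hΦ] at this
    exact ratVec_injective this

/-! ### Embedding both value groups in rational vector spaces. -/

theorem torFreeMk_eq_zero_iff {m : ℕ} {K : Submodule ℤ (Fin m → ℤ)} {v : Fin m → ℤ} :
    torFreeMk K v = 0 ↔ ∃ n : ℤ, n ≠ 0 ∧ n • v ∈ K := by
  rw [torFreeMk, Submodule.Quotient.mk_eq_zero, Submodule.mem_torsion_iff]
  constructor
  · rintro ⟨n, hn⟩
    refine ⟨n, nonZeroDivisors.coe_ne_zero n, ?_⟩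
    rw [← Submodule.Quotient.mk_eq_zero, Submodule.Quotient.mk_smul]
    exact hn
  · rintro ⟨n, hn, h⟩
    refine ⟨⟨n, mem_nonZeroDivisors_of_ne_zero hn⟩, ?_⟩
    rw [← Submodule.Quotient.mk_eq_zero, Submodule.Quotient.mk_smul] at h
    exact h

/-- The quotient map `ℤᵐ → T`. -/
def torFreeMkLin {m : ℕ} (K : Submodule ℤ (Fin m → ℤ)) : (Fin m → ℤ) →ₗ[ℤ] TorFree K :=
  (Submodule.torsion ℤ ((Fin m → ℤ) ⧸ K)).mkQ ∘ₗ K.mkQ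

/-- The value group `ℤ × ℤʳ` inside the rational vector space `ℚ × ℚʳ`. -/
def valueEmb {Γ : Type*} [AddCommGroup Γ] {r : ℕ} (e : Γ ≃+ (Fin r → ℤ)) :
    (ℤᵒᵈ ×ₗ Γ) →+ ℚ × (Fin r → ℚ) where
  toFun x := ((OrderDual.ofDual (ofLex x).1 : ℤ), fun j => (e (ofLex x).2 j : ℚ))
  map_zero' := by
    ext <;> simp
  map_add' x y := by
    ext <;> simp

theorem valueEmb_toLex {Γ : Type*} [AddCommGroup Γ] {r : ℕ} (e : Γ ≃+ (Fin r → ℤ)) (n : ℤ)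
    (a : Γ) : valueEmb e (toLex (OrderDual.toDual n, a)) = ((n : ℚ), fun j => (e a j : ℚ)) := rfl

theorem valueEmb_injective {Γ : Type*} [AddCommGroup Γ] {r : ℕ} (e : Γ ≃+ (Fin r → ℤ)) :
    Function.Injective (valueEmb e) := by
  intro x y h
  obtain ⟨h1, h2⟩ := Prod.mk.inj h
  refine ofLex.injective (Prod.ext (OrderDual.ofDual.injective (Int.cast_injective h1)) ?_)
  exact e.injective (funext fun j => Int.cast_injective (congrFun h2 j))

/-- Lets the comparison of the bodies be made on rational generating points, where the `ℚ`-linear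
factorizations apply. -/
theorem body_eq_closure_ratVec {B : Type*} [Zero B] {n : ℕ} (E : ℕ → Set B) (v : B → Fin n → ℝ)
    (w : B → Fin n → ℚ) (hw : ∀ f, v f = ratVec (w f)) :
    body E v = closure (convexHull ℝ
      (ratVec '' {x | ∃ i : ℕ, 0 < i ∧ ∃ f ∈ E i, f ≠ 0 ∧ x = (i : ℚ)⁻¹ • w f})) := by
  rw [body]
  congr 2
  have hs : ∀ (i : ℕ) f, (i : ℝ)⁻¹ • v f = ratVec ((i : ℚ)⁻¹ • w f) := by
    intro i f
    ext j
    simp [hw, ratVec]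
  ext x
  constructor
  · rintro ⟨i, hi, f, hf, h0, rfl⟩
    exact ⟨_, ⟨i, hi, f, hf, h0, rfl⟩, (hs i f).symm⟩
  · rintro ⟨_, ⟨i, hi, f, hf, h0, rfl⟩, rfl⟩
    exact ⟨i, hi, f, hf, h0, (hs i f).symm⟩

/-! ### Mediants, elements of degree zero, and lifting homogeneous elements to the presentation. -/

section

variable {k A' Γ : Type*} [Field k] [CommRing A'] [Algebra k A'] [AddCommGroup Γ]
    [LinearOrder Γ] [IsOrderedAddMonoid Γ] {r : ℕ} {e : Γ ≃+ (Fin r → ℤ)}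
    {ν' : KValuation k A' Γ} {𝒜 : ℕ → Submodule k A'} [SetLike.GradedMonoid 𝒜]
    {m : ℕ} {g : Fin m → ⨁ i, 𝒜 i} {tie ord : MonomialOrder (Fin m)} {n : ℕ}

/-- A weighted mediant of vectors lies in the convex hull of their normalizations. -/
theorem inv_smul_sum_mem_convexHull {ι E : Type*} [Fintype ι] [AddCommGroup E] [Module ℝ E]
    (c d : ι → ℝ) (a : ι → E) (hc : ∀ j, 0 ≤ c j) (hd : ∀ j, 0 ≤ d j)
    (ha : ∀ j, d j = 0 → a j = 0) (hpos : 0 < ∑ j, c j * d j) :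
    (∑ j, c j * d j)⁻¹ • ∑ j, c j • a j ∈
      convexHull ℝ {x | ∃ j, 0 < d j ∧ x = (d j)⁻¹ • a j} := by
  classical
  -- The weights are `c j * d j`, since `c j • a j = (c j * d j) • ((d j)⁻¹ • a j)` when `d j > 0`;
  -- the remaining terms vanish by `ha`.
  have h1 : (∑ j, c j * d j)⁻¹ • ∑ j, c j • a j =
      (Finset.univ.filter fun j => 0 < d j).centerMass (fun j => c j * d j)
        (fun j => (d j)⁻¹ • a j) := by
    rw [Finset.centerMass, Finset.sum_filter_of_ne, Finset.sum_filter_of_ne]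
    · congr 1
      refine Finset.sum_congr rfl fun j _ => ?_
      rcases (hd j).eq_or_lt with h | h
      · rw [ha j h.symm]; simp
      · rw [smul_smul, mul_assoc, mul_inv_cancel₀ h.ne', mul_one]
    · intro j _ hne
      exact (hd j).lt_of_ne fun h => hne (by rw [ha j h.symm]; simp)
    · intro j _ hne
      exact (hd j).lt_of_ne fun h => hne (by rw [← h, mul_zero])
  rw [h1]
  refine Finset.centerMass_mem_convexHull _ (fun j _ => mul_nonneg (hc j) (hd j)) ?_ ?_
  · rwa [Finset.sum_filter_of_ne]
    intro j _ hne
    exact (hd j).lt_of_ne fun h => hne (by rw [← h, mul_zero])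
  · intro j hj
    exact ⟨j, (Finset.mem_filter.1 hj).2, rfl⟩

/-- Elements of degree `0` have value `0`, as `A₀ = k`. -/
theorem value_leadingCoeff_eq_zero (h𝒜 : 𝒜 0 = 1) {f : ⨁ i, 𝒜 i} (hf : f ≠ 0)
    (hd : (KValuation.toPoly 𝒜 f).natDegree = 0) :
    ν'.value (KValuation.toPoly 𝒜 f).leadingCoeff = 0 := by
  have h0 : (KValuation.toPoly 𝒜 f).leadingCoeff ≠ 0 := by
    simpa using KValuation.toPoly_ne_zero 𝒜 hf
  have h1 : (KValuation.toPoly 𝒜 f).leadingCoeff ∈ 𝒜 0 := by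
    rw [Polynomial.leadingCoeff, hd, KValuation.coeff_toPoly]
    exact (f 0).2
  rw [h𝒜, Submodule.mem_one] at h1
  obtain ⟨c, hc⟩ := h1
  rw [← hc] at h0 ⊢
  have hc0 : c ≠ 0 := by
    rintro rfl
    exact h0 (map_zero _)
  rw [KValuation.value, ν'.val_algebraMap c hc0]
  rfl

/-- Subduction makes the presentation map surjective, so every normalized value in the body of `A`
comes from a class of `R / I`. -/
theorem exists_presPiece_preimage (hν : (ν'.induced 𝒜).valueSet.WellFoundedOn (· > ·))
    (hg : (ν'.induced 𝒜).IsKhovanskiiBasis g) {i : ℕ} {f : 𝒜 i} (hf : f ≠ 0) :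
    ∃ q : MvPolynomial (Fin m) k ⧸ presIdeal 𝒜 g, q ≠ 0 ∧
      Ideal.kerLiftAlg (MvPolynomial.aeval (R := k) g) q = DirectSum.of (fun i => 𝒜 i) i f := by
  obtain ⟨p, hp, -⟩ := (ν'.induced 𝒜).exists_aeval_eq hν hg (DirectSum.of (fun i => 𝒜 i) i f)
  refine ⟨Ideal.Quotient.mk _ p, ?_, by rw [Ideal.kerLiftAlg_mk, hp]⟩
  rw [Ne, Ideal.Quotient.eq_zero_iff_mem, RingHom.mem_ker, hp]
  intro h
  apply hf
  have := congrArg (fun x : ⨁ i, 𝒜 i => x i) h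
  simpa [DirectSum.of_eq_same] using this

end

end NewtonOkounkov

/-! ### Comparison of the two bodies. -/

open NewtonOkounkov
/-- `Γ` is `ℤʳ` (through `e`) with an arbitrary translation-invariant total order. The graded algebra is
`A = ⨁ Aᵢ` with `A₀ = k` and `Aᵢ ⊆ A'`, multiplied as in `A'`. -/
theorem mainTheorem9 {k A' Γ : Type*} [Field k] [CommRing A'] [Algebra k A']
    [AddCommGroup Γ] [LinearOrder Γ] [IsOrderedAddMonoid Γ] {r : ℕ} (e : Γ ≃+ (Fin r → ℤ))
    (ν' : KValuation k A' Γ) (hν' : ν'.StandingHypotheses)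
    (𝒜 : ℕ → Submodule k A') [SetLike.GradedMonoid 𝒜] (h𝒜 : 𝒜 0 = 1)
    {m : ℕ} (g : Fin m → ⨁ i, 𝒜 i) (hg : (ν'.induced 𝒜).IsKhovanskiiBasis g)
    (tie ord : MonomialOrder (Fin m)) (hord : IsInducedOrder (ν'.induced 𝒜) g tie ord)
    {n : ℕ} (ι : TorFree (latticeK ord (presIdeal 𝒜 g)) →ₗ[ℤ] (Fin n → ℚ))
    (hι : Function.Injective ι) :
    IsRationalPolytope (bodyA ν' 𝒜 e) ∧
    IsRationalPolytope (bodyRI 𝒜 g ord ι) ∧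
    RatAffineEquivalent (bodyRI 𝒜 g ord ι) (bodyA ν' 𝒜 e) := by
  classical
  set ν := ν'.induced 𝒜 with hνdef
  have hwf : ν.valueSet.WellFoundedOn (· > ·) :=
    KValuation.wellFoundedOn_valueSet_induced 𝒜 hν'.wellOrdered
  have hl : ν.HasLeafCancellation := KValuation.hasLeafCancellation_induced 𝒜
    (ν'.hasLeafCancellation_of_rank_le_one hν'.leaves)
  let a : (Fin m → ℤ) →ₗ[ℤ] (Fin n → ℚ) := ι ∘ₗ torFreeMkLin (latticeK ord (presIdeal 𝒜 g))
  let b : (Fin m → ℤ) →ₗ[ℤ] ℚ × (Fin r → ℚ) :=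
    (valueEmb e).toIntLinearMap ∘ₗ ν.weight g
  have hb0 : ∀ v, b v = 0 → ν.weight g v = 0 := fun v hv =>
    valueEmb_injective e (hv.trans (map_zero (valueEmb e)).symm)
  have hab : ∀ v, a v = 0 → b v = 0 := by
    intro v hv
    have h1 : torFreeMk (latticeK ord (presIdeal 𝒜 g)) v = 0 := hι (hv.trans (map_zero ι).symm)
    obtain ⟨N, hN, hmem⟩ := torFreeMk_eq_zero_iff.1 h1
    -- Only a multiple of `v` is known to lie in the lattice; the target of `b` is torsion-free, so
    -- that suffices.
    have h2 : N • b v = 0 := by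
      rw [← map_smul]
      exact (congrArg (valueEmb e) (KValuation.weight_latticeK hg.1 hord hmem)).trans (map_zero _)
    exact (smul_eq_zero.1 h2).resolve_left hN
  have hba : ∀ v, b v = 0 → a v = 0 := by
    intro v hv
    have h1 := KValuation.mem_latticeK hwf hl hg hord (hb0 v hv)
    have h2 : torFreeMk (latticeK ord (presIdeal 𝒜 g)) v = 0 :=
      torFreeMk_eq_zero_iff.2 ⟨1, one_ne_zero, by rwa [one_smul]⟩
    exact (congrArg ι h2).trans (map_zero ι)
  -- The kernels of `a` and `b` coincide, so `L` and `M` are mutually inverse between the rational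
  -- spans of their images.
  obtain ⟨L, hL⟩ := exists_ratLinearMap_comp_eq a b hab
  obtain ⟨M, hM⟩ := exists_ratLinearMap_comp_eq b a hba
  -- the exponent of the leading monomial of the normal form computes both values
  have hexp : ∀ (i : ℕ) (f : 𝒜 i) (q : MvPolynomial (Fin m) k ⧸ presIdeal 𝒜 g), q ≠ 0 → f ≠ 0 →
      Ideal.kerLiftAlg (MvPolynomial.aeval (R := k) g) q = DirectSum.of (fun i => 𝒜 i) i f →
      ∃ α : Fin m →₀ ℕ, ι (mu ord (presIdeal 𝒜 g) q) = -a (intExp α) ∧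
        b (intExp α) = ((i : ℚ), fun j => (e (ν'.value (f : A')) j : ℚ)) := by
    intro i f q hq hf hqf
    refine ⟨ord.degree (normalForm ord _ q), ?_, ?_⟩
    · rw [← map_neg]
      rfl
    · have h1 := KValuation.value_kerLiftAlg hwf hl hg hord hq
      rw [hqf, KValuation.induced_value_of 𝒜 hf] at h1
      exact (congrArg (valueEmb e) h1.symm).trans (valueEmb_toLex e _ _)
  -- The sign undoes the minus in `μ`. In the other direction, the constant term `-M (1, 0)`
  -- restores the degree coordinate, which equals `1` after division by `i`.
  let φ : (Fin n → ℚ) →ᵃ[ℚ] (Fin r → ℚ) := (-(LinearMap.snd ℚ ℚ (Fin r → ℚ) ∘ₗ L)).toAffineMap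
  let ψ : (Fin r → ℚ) →ᵃ[ℚ] (Fin n → ℚ) :=
    (-(M ∘ₗ LinearMap.inr ℚ ℚ (Fin r → ℚ))).toAffineMap + AffineMap.const ℚ _ (-M (1, 0))
  have hφ : ∀ x, φ x = -(L x).2 := fun _ => rfl
  have hψ : ∀ x, ψ x = -M (1, x) := by
    intro x
    have h1 : ψ x = -M (0, x) + -M (1, 0) := rfl
    rw [h1, ← neg_add, ← map_add]
    simp
  have hφψ : ∀ (i : ℕ) (f : 𝒜 i) (q : MvPolynomial (Fin m) k ⧸ presIdeal 𝒜 g), 0 < i → q ≠ 0 →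
      f ≠ 0 →
      Ideal.kerLiftAlg (MvPolynomial.aeval (R := k) g) q = DirectSum.of (fun i => 𝒜 i) i f →
      φ ((i : ℚ)⁻¹ • ι (mu ord (presIdeal 𝒜 g) q)) =
        (i : ℚ)⁻¹ • (fun j => (e (ν'.value (f : A')) j : ℚ)) ∧
      ψ ((i : ℚ)⁻¹ • (fun j => (e (ν'.value (f : A')) j : ℚ))) =
        (i : ℚ)⁻¹ • ι (mu ord (presIdeal 𝒜 g) q) := by
    intro i f q hi hq hf hqf
    obtain ⟨α, h1, h2⟩ := hexp i f q hq hf hqf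
    have hi0 : (i : ℚ) ≠ 0 := Nat.cast_ne_zero.2 hi.ne'
    constructor
    · rw [hφ, h1, map_smul, map_neg, hL, h2]
      simp
    · rw [hψ, h1, smul_neg, ← hM, h2, ← map_smul]
      simp [hi0]
  have hA : bodyA ν' 𝒜 e = _ := body_eq_closure_ratVec (fun i => (𝒜 i : Set A')) _
    (fun f j => (e (ν'.value f) j : ℚ)) (fun f => by ext j; simp [ratVec])
  have hRI : bodyRI 𝒜 g ord ι = _ := body_eq_closure_ratVec (presPiece 𝒜 g) _
    (fun q => ι (mu ord (presIdeal 𝒜 g) q)) (fun f => rfl)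
  have hsrc : ∀ {i : ℕ} {q : MvPolynomial (Fin m) k ⧸ presIdeal 𝒜 g}, q ∈ presPiece 𝒜 g i →
      q ≠ 0 → ∃ f : 𝒜 i, f ≠ 0 ∧
        Ideal.kerLiftAlg (MvPolynomial.aeval (R := k) g) q = DirectSum.of (fun i => 𝒜 i) i f := by
    rintro i q ⟨f, hf⟩ hq
    refine ⟨f, ?_, hf⟩
    rintro rfl
    rw [map_zero] at hf
    exact hq (Ideal.kerLiftAlg_injective _ (hf.trans (map_zero _).symm))
  -- the degrees and values of the generators
  let d : Fin m → ℕ := fun j => (KValuation.toPoly 𝒜 (g j)).natDegree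
  let w : Fin m → Γ := fun j => ν'.value (KValuation.toPoly 𝒜 (g j)).leadingCoeff
  have hvg : ∀ j, valueEmb e (ν.value (g j)) = ((d j : ℚ), fun l => (e (w j) l : ℚ)) := by
    intro j
    rw [KValuation.induced_value_eq 𝒜 (hg.1 j), valueEmb_toLex]
    simp [d, w]
  have hbα : ∀ α : Fin m →₀ ℕ, b (intExp α) =
      ∑ j, (α j : ℚ) • (((d j : ℚ), fun l => (e (w j) l : ℚ)) : ℚ × (Fin r → ℚ)) := by
    intro α
    change valueEmb e (ν.weight g (intExp α)) = _
    rw [KValuation.weight, Fintype.linearCombination_apply, map_sum]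
    refine Finset.sum_congr rfl fun j _ => ?_
    rw [map_zsmul, hvg, intExp, ← Int.cast_smul_eq_zsmul ℚ, Int.cast_natCast]
  -- Candidate spanning points: the normalized values of the top components of the generators of
  -- positive degree. A generator need not be homogeneous, but its top component is a nonzero
  -- element of degree `d j`.
  let V : Set (Fin r → ℚ) := (fun j => (d j : ℚ)⁻¹ • fun l => (e (w j) l : ℚ)) '' {j | 0 < d j}
  rw [hA, hRI]
  refine ratAffineEquivalent_of_inverse (V := V) (Set.toFinite _) ?_ ?_ φ ψ ?_ ?_ ?_ ?_
  · rintro _ ⟨j, hj, rfl⟩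
    refine ⟨d j, hj, (KValuation.toPoly 𝒜 (g j)).leadingCoeff, ?_, ?_, rfl⟩
    · rw [Polynomial.leadingCoeff, KValuation.coeff_toPoly]
      exact (g j (d j)).2
    · simpa using KValuation.toPoly_ne_zero 𝒜 (hg.1 j)
  · rintro _ ⟨_, ⟨i, hi, f, hf, hf0, rfl⟩, rfl⟩
    have hf0' : (⟨f, hf⟩ : 𝒜 i) ≠ 0 := by simpa using hf0
    obtain ⟨q, hq, hqf⟩ := exists_presPiece_preimage hwf hg hf0'
    obtain ⟨α, -, h2⟩ := hexp i ⟨f, hf⟩ q hq hf0' hqf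
    rw [hbα] at h2
    have h3 : (∑ j, (α j : ℝ) * (d j : ℝ)) = i := by
      have := congrArg Prod.fst h2
      simp only [Prod.fst_sum, Prod.smul_fst, smul_eq_mul] at this
      exact_mod_cast this
    have h4 : ∑ j, (α j : ℝ) • ratVec (fun l => (e (w j) l : ℚ)) =
        ratVec fun l => (e (ν'.value f) l : ℚ) := by
      have := congrArg Prod.snd h2
      simp only [Prod.snd_sum, Prod.smul_snd] at this
      rw [← this]
      ext l
      simp [ratVec]
    -- The two coordinates of `(i, ν'(f)) = ∑ αⱼ (dⱼ, wⱼ)` supply the denominator and numerator of a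
    -- mediant; generators with `dⱼ = 0` have `wⱼ = 0`.
    have h5 := inv_smul_sum_mem_convexHull (fun j => (α j : ℝ)) (fun j => (d j : ℝ))
      (fun j => ratVec (fun l => (e (w j) l : ℚ))) (fun _ => Nat.cast_nonneg _)
      (fun _ => Nat.cast_nonneg _) (fun j hj => by
        have : w j = 0 := value_leadingCoeff_eq_zero h𝒜 (hg.1 j) (Nat.cast_eq_zero.1 hj)
        ext l
        simp [this, ratVec]) (by rw [h3]; exact_mod_cast hi)
    rw [h3, h4] at h5
    have h6 : ratVec ((i : ℚ)⁻¹ • fun l => (e (ν'.value f) l : ℚ)) =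
        (i : ℝ)⁻¹ • ratVec fun l => (e (ν'.value f) l : ℚ) := by
      ext l
      simp [ratVec]
    rw [h6]
    refine convexHull_mono ?_ h5
    rintro _ ⟨j, hj, rfl⟩
    refine ⟨_, ⟨j, (Nat.cast_pos (α := ℝ)).1 hj, rfl⟩, ?_⟩
    ext l
    simp [ratVec]
  · rintro _ ⟨i, hi, q, hq, hq0, rfl⟩
    obtain ⟨f, hf, hqf⟩ := hsrc hq hq0
    rw [(hφψ i f q hi hq0 hf hqf).1]
    exact ⟨i, hi, f, f.2, by simpa using hf, rfl⟩
  · rintro _ ⟨i, hi, f, hf, hf0, rfl⟩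
    have hf0' : (⟨f, hf⟩ : 𝒜 i) ≠ 0 := by simpa using hf0
    obtain ⟨q, hq, hqf⟩ := exists_presPiece_preimage hwf hg hf0'
    rw [(hφψ i ⟨f, hf⟩ q hi hq hf0' hqf).2]
    exact ⟨i, hi, q, ⟨_, hqf⟩, hq, rfl⟩
  · rintro _ ⟨i, hi, q, hq, hq0, rfl⟩
    obtain ⟨f, hf, hqf⟩ := hsrc hq hq0
    rw [(hφψ i f q hi hq0 hf hqf).1, (hφψ i f q hi hq0 hf hqf).2]
  · rintro _ ⟨i, hi, f, hf, hf0, rfl⟩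
    have hf0' : (⟨f, hf⟩ : 𝒜 i) ≠ 0 := by simpa using hf0
    obtain ⟨q, hq, hqf⟩ := exists_presPiece_preimage hwf hg hf0'
    rw [(hφψ i ⟨f, hf⟩ q hi hq hf0' hqf).2, (hφψ i ⟨f, hf⟩ q hi hq hf0' hqf).1]
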